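/- \textbf{Setting.} A power series $F(z)=\sum_{n\ge 0} a_n z^n/n!\in\overline{\mathbb Q}[[z]]$ is an \emph{$E$-function} (in Siegel's sense) if it satisfies a non-zero linear differential equation with coefficients in $\overline{\mathbb Q}(z)$ and if, for every $\varepsilon>0$, all Galois conjugates of $a_n$ have modulus at most $n!^{\varepsilon}$ for $n$ large, and there are integers $d_n\ge 1$ (independent of $\varepsilon$) such that $d_na_0,\dots,d_na_n$ are algebraic integers for every $n$ and, for every $\varepsilon>0$, $d_n\le n!^{\varepsilon}$ for $n$ large. (This includes $E$-functions in the strict sense, where $n!^\varepsilon$ is replaced by $C^{n+1}$.) Let $m\ge 1$ and let $f_1,\dots,f_m\in\mathbb Q[[z]]$ be $E$-functions such that $1,f_1,\dots,f_m$ are linearly independent over $\mathbb C(z)$. Assume that $$f_l'(z)=S_{l,0}(z)+\sum_{j=1}^m S_{l,j}(z)f_j(z)\qquad(1\le l\le m)$$ with $S_{l,j}\in\mathbb Q[z,1/z]$, and that $0$ is a regular point or a regular singularity of the corresponding homogeneous system satisfied by ${}^t(1,f_1,\dots,f_m)$. For $N\ge 1$ put $|\kappa|=\kappa_1+\dots+\kappa_m$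 for $\kappa\in\mathbb N^m$, $\Omega=\{\kappa\in\mathbb N^m: N-1\le|\kappa|\le N\}$, $\Theta=\{\kappa\in\mathbb N^m:|\kappa|=N\}$, $\omega=\mathrm{Card}\,\Omega$, $\theta=\mathrm{Card}\,\Theta$, and let $e_1,\dots,e_m$ be the canonical basis of $\mathbb Z^m$. Let $A=(A_{\lambda,\kappa})_{\lambda,\kappa\in\Omega}$ be the matrix with $$A_{\lambda,\kappa}=\begin{cases}-\lambda_jS_{l,j}&\text{if }\kappa=\lambda-e_j+e_l\text{ with }j\ne l,\\-\sum_{j=1}^m\lambda_jS_{j,j}&\text{if }\kappa=\lambda,\\S_{j,0}&\text{if }\kappa=\lambda+e_j\text{ and }|\lambda|=N-1,\\0&\text{otherwise.}\end{cases}$$ For $\kappa\in\Theta$ let $Z_\kappa=(z_{\kappa,\lambda})_{\lambda\in\Omega}\in\mathbb C^\Omega$ be given by $z_{\kappa,\kappa}=1$, $z_{\kappa,\kappa-e_j}=f_j(1)$ for each $j$ with $\kappa_j\ge 1$, and $z_{\kappa,\lambda}=0$ for all other $\lambda$. Let $0<\eta\le\frac1{3(N+m-1)}$, let $M\ge 0$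 be an integer, and $K=\lfloor(\omega-\eta)M/\theta\rfloor$. Let $P_\kappa\in\mathbb C[z]$ $(\kappa\in\Omega)$ be polynomials of degree less than $M$, not all zero, such that $\mathrm{ord}_0\bigl(P_\kappa+\sum_{j=1}^mP_{\kappa-e_j}f_j\bigr)\ge K$ for every $\kappa\in\Theta$, where $P_{\kappa-e_j}$ is read as $0$ if $\kappa_j=0$. For a solution $Y=(y_\kappa)_{\kappa\in\Omega}$ of $Y'=AY$ put $R(Y)(z)=\sum_{\kappa\in\Omega}P_\kappa(z)y_\kappa(z)$. \textbf{Proposition.} There is a constant $c>0$, depending only on $f_1,\dots,f_m$ (and not on $N,\eta,M$ or the $P_\kappa$), such that for all data as above there exist holomorphic solutions $Y_\kappa$ $(\kappa\in\Theta)$ of $Y'=AY$ on the slit plane $\mathbb C\setminus(-\infty,0]$ with the following properties: (i) $Y_\kappa(1)=Z_\kappa$ for every $\kappa\in\Theta$; (ii) the functions $Y_\kappa$, $\kappa\in\Theta$, are linearly independent over $\mathbb C$; (iii) $R(Y_\kappa)(z)=O(|z|^{K-cN})$ as $z\to 0$ in the slit plane, for every $\kappa\in\Theta$; (iv) for every $\kappa\in\Theta$,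 $R(Y_\kappa)$ belongs to the Nilsson class at $0$: near $0$ in the slit plane it is equal to a finite sum $\sum_{e\in E}\sum_{i\in I}h_{e,i}(z)z^e(\log z)^i$ with $E\subset\mathbb C$ and $I\subset\mathbb N$ finite, each $h_{e,i}$ holomorphic at $0$, and $\log$ the principal determination. -/

import Mathlib

open scoped Polynomial LaurentPolynomial BigOperators Topology Asymptotics RatFunc

noncomputable section

namespace GradedPade

/-- `E`-functions (in Siegel's sense): power series `F = ∑ aₙ zⁿ / n!` with coefficients in `ℚ̄` such
that
(i) `F` satisfies a non-zero linear differential equation with coefficients in `ℚ̄(z)`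
(equivalently, after clearing denominators, in `ℚ̄[z]`);
(ii) for every `ε > 0`, all conjugates of `aₙ` have modulus at most `(n!)^ε` for `n` large;
(iii) there are integers `dₙ ≥ 1` with `dₙ a₀, …, dₙ aₙ` algebraic integers, and for every `ε > 0`,
`dₙ ≤ (n!)^ε` for `n` large.
The `E`-functions in the strict sense (bounds `C^(n+1)` in place of `(n!)^ε`) are among these. -/
def IsEFunction (F : PowerSeries (AlgebraicClosure ℚ)) : Prop :=
  (∃ (r : ℕ) (p : Fin (r + 1) → (AlgebraicClosure ℚ)[X]), p ≠ 0 ∧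
    ∑ j : Fin (r + 1), (p j : PowerSeries (AlgebraicClosure ℚ)) *
      (PowerSeries.derivative (AlgebraicClosure ℚ))^[(j : ℕ)] F = 0) ∧
  (∀ ε : ℝ, 0 < ε → ∃ n₀ : ℕ, ∀ n ≥ n₀, ∀ σ : AlgebraicClosure ℚ →+* ℂ,
    ‖σ ((n.factorial : AlgebraicClosure ℚ) * PowerSeries.coeff n F)‖ ≤ (n.factorial : ℝ) ^ ε) ∧
  (∃ d : ℕ → ℕ,
    (∀ n, 1 ≤ d n ∧ ∀ k ≤ n, IsIntegral ℤ
      ((d n : AlgebraicClosure ℚ) *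
        ((k.factorial : AlgebraicClosure ℚ) * PowerSeries.coeff k F))) ∧
    ∀ ε : ℝ, 0 < ε → ∃ n₀ : ℕ, ∀ n ≥ n₀, (d n : ℝ) ≤ (n.factorial : ℝ) ^ ε)

/-- A power series with rational coefficients, seen in `ℂ[[z]]`. -/
def toC (F : PowerSeries ℚ) : PowerSeries ℂ := F.map (algebraMap ℚ ℂ)

/-- The sum at `z ∈ ℂ` of a power series with rational coefficients
(used for `E`-functions only, which converge everywhere). -/
def evalSeries (F : PowerSeries ℚ) (z : ℂ) : ℂ :=
  ∑' n : ℕ, ((PowerSeries.coeff n F : ℚ) : ℂ) * z ^ n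

/-- The value at `z ≠ 0` of a Laurent polynomial `s ∈ ℚ[z, 1/z]`. -/
def evalLaurent (s : ℚ[T;T⁻¹]) (z : ℂ) : ℂ :=
  s.coeff.sum fun n a => (a : ℂ) * z ^ n

/-- A Laurent polynomial `s ∈ ℚ[z, 1/z]`, seen in `ℂ((z))`. -/
def laurentToSeries (s : ℚ[T;T⁻¹]) : LaurentSeries ℂ :=
  s.coeff.sum fun n a => HahnSeries.single n (a : ℂ)

/-- The family `1, f₁, …, f_m` in `ℂ((z))`. -/
def oneAndSeries {m : ℕ} (f : Fin m → PowerSeries ℚ) : Fin (m + 1) → LaurentSeries ℂ :=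
  Fin.cons 1 fun j => HahnSeries.ofPowerSeries ℤ ℂ (toC (f j))

/-- The functions `1, f₁, …, f_m` are linearly independent over the field `ℂ(z)`. -/
def IndependentOverRational {m : ℕ} (f : Fin m → PowerSeries ℚ) : Prop :=
  LinearIndependent (RatFunc ℂ) (oneAndSeries f)

/-- `(f₁, …, f_m)` is a solution, on `ℂ \ {0}`, of the inhomogeneous system
`f_l' = S_{l,0} + ∑_{j=1}^m S_{l,j} f_j`.  Here `S l 0` is `S_{l,0}`, and `S l j.succ` is the
coefficient of `f j`. -/
def SolvesInhomogeneous {m : ℕ} (S : Fin m → Fin (m + 1) → ℚ[T;T⁻¹])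
    (f : Fin m → PowerSeries ℚ) : Prop :=
  ∀ l : Fin m, ∀ z : ℂ, z ≠ 0 →
    HasDerivAt (evalSeries (f l))
      (evalLaurent (S l 0) z + ∑ j : Fin m, evalLaurent (S l j.succ) z * evalSeries (f j) z) z

/-- The matrix, with coefficients in `ℂ((z))`, of the homogeneous system of size `m + 1` satisfied
by the column vector `(1, f₁, …, f_m)`: its first row is zero. -/
def homogeneousMatrix {m : ℕ} (S : Fin m → Fin (m + 1) → ℚ[T;T⁻¹]) :
    Matrix (Fin (m + 1)) (Fin (m + 1)) (LaurentSeries ℂ) :=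
  Matrix.of (Fin.cons (fun _ => 0) fun l j => laurentToSeries (S l j))

/-- The point `0` is a regular point or a regular singularity of `Y' = B Y`: by some change of
unknown `Y = G W` with `G ∈ GL_n(ℂ((z)))` the system becomes `z W' = H W` with `H ∈ M_n(ℂ[[z]])`,
that is, `z (B G - G') = G H`. -/
def IsRegularSingularAtZero {n : ℕ} (B : Matrix (Fin n) (Fin n) (LaurentSeries ℂ)) : Prop :=
  ∃ (G : Matrix (Fin n) (Fin n) (LaurentSeries ℂ)) (H : Matrix (Fin n) (Fin n) (PowerSeries ℂ)),
    IsUnit G.det ∧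
    (HahnSeries.single (1 : ℤ) (1 : ℂ)) • (B * G - G.map (LaurentSeries.derivative ℂ)) =
      G * H.map (HahnSeries.ofPowerSeries ℤ ℂ)

/-- `Ω = {κ ∈ ℕ^m : N - 1 ≤ |κ| ≤ N}`. -/
def Omega (m N : ℕ) : Finset (Fin m → ℕ) :=
  (Fintype.piFinset fun _ => Finset.range (N + 1)).filter
    fun κ => N ≤ (∑ j, κ j) + 1 ∧ ∑ j, κ j ≤ N

/-- `Θ = {κ ∈ ℕ^m : |κ| = N}`. -/
def Theta (m N : ℕ) : Finset (Fin m → ℕ) :=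
  (Fintype.piFinset fun _ => Finset.range (N + 1)).filter fun κ => ∑ j, κ j = N

theorem mem_Omega {m N : ℕ} {κ : Fin m → ℕ} :
    κ ∈ Omega m N ↔ N ≤ (∑ j, κ j) + 1 ∧ ∑ j, κ j ≤ N := by
  simp only [Omega, Finset.mem_filter, Fintype.mem_piFinset, Finset.mem_range, and_iff_right_iff_imp]
  rintro ⟨-, h⟩ j
  exact Nat.lt_succ_of_le
    ((Finset.single_le_sum (fun i _ => Nat.zero_le (κ i)) (Finset.mem_univ j)).trans h)

theorem mem_Theta {m N : ℕ} {κ : Fin m → ℕ} : κ ∈ Theta m N ↔ ∑ j, κ j = N := by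
  simp only [Theta, Finset.mem_filter, Fintype.mem_piFinset, Finset.mem_range, and_iff_right_iff_imp]
  rintro h j
  exact Nat.lt_succ_of_le
    ((Finset.single_le_sum (fun i _ => Nat.zero_le (κ i)) (Finset.mem_univ j)).trans h.le)

/-- The canonical vector `e_j ∈ ℕ^m`. -/
def e {m : ℕ} (j : Fin m) : Fin m → ℕ := Pi.single j 1

/-- The matrix `A = (A_{λ,κ})`, for `λ, κ ∈ Ω`, where `A_{λ,κ}` equals
`- λ_j S_{l,j}` if `κ = λ - e_j + e_l` with `j ≠ l`;
`- ∑_j λ_j S_{j,j}` if `κ = λ`;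
`S_{j,0}` if `κ = λ + e_j` and `|λ| = N - 1`;
`0` otherwise.
The first two cases together are the first sum (the diagonal `κ = λ` collects the terms with `j = l`),
and `κ = λ + e_j` forces `|λ| = N - 1` for `λ, κ ∈ Ω`. -/
def systemMatrix {m : ℕ} (S : Fin m → Fin (m + 1) → ℚ[T;T⁻¹]) (N : ℕ) :
    Matrix (Omega m N) (Omega m N) ℚ[T;T⁻¹] :=
  Matrix.of fun lam κ =>
    (∑ j : Fin m, ∑ l : Fin m,
      if (κ : Fin m → ℕ) + e j = (lam : Fin m → ℕ) + e l
        then -((lam.1 j : ℚ[T;T⁻¹]) * S l j.succ) else 0) +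
    ∑ j : Fin m, if (κ : Fin m → ℕ) = (lam : Fin m → ℕ) + e j then S j 0 else 0

/-- `Y` is a solution of `Y' = A Y` on the slit plane `ℂ \ ]-∞, 0]`. -/
def IsSolution {ι : Type*} [Fintype ι] (A : Matrix ι ι ℚ[T;T⁻¹]) (Y : ℂ → ι → ℂ) : Prop :=
  ∀ z ∈ Complex.slitPlane,
    HasDerivAt Y ((A.map fun s => evalLaurent s z).mulVec (Y z)) z

/-- The vector `Z_κ = (z_{κ,λ})`, `λ ∈ Ω`: `z_{κ,λ}` is `1` if `λ = κ`, it is `f_j(1)` if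
`λ = κ - e_j` for some (then unique) `j`, and `0` otherwise. -/
def Z {m : ℕ} (f : Fin m → PowerSeries ℚ) (N : ℕ) (κ : Fin m → ℕ) : Omega m N → ℂ :=
  fun lam => (if (lam : Fin m → ℕ) = κ then 1 else 0) +
    ∑ j : Fin m, if (lam : Fin m → ℕ) + e j = κ then evalSeries (f j) 1 else 0

/-- `P_{κ - e_j}`, with the convention that it is `0` if `κ - e_j` has a negative component. -/
def shift {m : ℕ} (P : (Fin m → ℕ) → ℂ[X]) (κ : Fin m → ℕ) (j : Fin m) : ℂ[X] :=
  if κ j = 0 then 0 else P (κ - e j)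

/-- Graded Padé approximants with parameters `N, M, K`: polynomials `P_κ`, `κ ∈ Ω`, of degree less
than `M`, not all zero, with `ord₀ (P_κ + ∑_j P_{κ - e_j} f_j) ≥ K` for all `κ ∈ Θ`
(the values of `P` outside `Ω` play no role). -/
structure IsGradedPade {m : ℕ} (f : Fin m → PowerSeries ℚ) (N M K : ℕ)
    (P : (Fin m → ℕ) → ℂ[X]) : Prop where
  degree_lt : ∀ κ ∈ Omega m N, (P κ).degree < M
  not_all_zero : ∃ κ ∈ Omega m N, P κ ≠ 0
  le_order : ∀ κ ∈ Theta m N,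
    (K : ℕ∞) ≤ ((P κ : PowerSeries ℂ) +
      ∑ j : Fin m, (shift P κ j : PowerSeries ℂ) * toC (f j)).order

/-- `K = ⌊(ω - η) M / θ⌋` with `ω = Card Ω`, `θ = Card Θ`. -/
def paramK (m N M : ℕ) (η : ℝ) : ℕ :=
  ⌊((Omega m N).card - η) * M / (Theta m N).card⌋₊

/-- The remainder `R(Y)(z) = ∑_{κ ∈ Ω} P_κ(z) y_κ(z)`. -/
def remainder {m N : ℕ} (P : (Fin m → ℕ) → ℂ[X]) (Y : ℂ → Omega m N → ℂ) (z : ℂ) : ℂ :=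
  ∑ κ : Omega m N, (P κ).eval z * Y z κ

/-- Nilsson class at `0`, for functions on the slit plane: near `0`, the function is a finite sum
`∑_{e ∈ E} ∑_{i ∈ I} h_{e,i}(z) z^e (log z)^i` with `h_{e,i}` holomorphic at `0`, and with the
principal determination of the logarithm. -/
def IsNilsson (g : ℂ → ℂ) : Prop :=
  ∃ (E : Finset ℂ) (I : Finset ℕ) (h : ℂ → ℕ → ℂ → ℂ),
    (∀ a ∈ E, ∀ i ∈ I, AnalyticAt ℂ (h a i) 0) ∧
    ∀ᶠ z in 𝓝[Complex.slitPlane] (0 : ℂ),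
      g z = ∑ a ∈ E, ∑ i ∈ I, h a i z * z ^ a * Complex.log z ^ i

end GradedPade

end

/-!
The graded system `Y' = A Y` is solved by monomials. Let `S = (S_{l,j})_{l,j ≥ 1}` and let `u(z)` be a
solution of the adjoint system `u_j' = - ∑_l S_{l,j} u_l`. Then `F = ∑ f_j u_j` satisfies
`F' = ∑ S_{j,0} u_j`, and it follows that `y_λ = u^λ` for `|λ| = N`, `y_λ = u^λ F` for `|λ| = N - 1`
is a solution of `Y' = A Y` (`sum_systemMatrix_smul`, `isSolution_gradedY`). For `u = U t`, with `U`
the fundamental matrix normalised by `U(1) = 1` and `t = (t₁, …, t_m)` indeterminates, the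
coefficient of `t^κ` in this generating solution is `Y_κ`; at `z = 1` it is `Z_κ` (`gradedY_one`),
which gives the linear independence. Regrouping the terms,
`R(Y_κ) = ∑_{|κ'| = N} (P_κ' + ∑_j P_{κ' - e_j} f_j) [t^κ] (U t)^κ'` (`remainder_gradedY`):
the first factors are holomorphic and `O(|z|^K)` at `0` by hypothesis, and the second ones are forms
of degree `N` in the entries of `U`. It is therefore enough that the entries of `U` belong to the
Nilsson class and are `O(|z|^(-c))`.

This is the theory of regular singular points (`IsRegularSingularAtZero.exists_fundamental_matrix`),
for the adjoint of the system of size `m + 1` satisfied by `(1, f₁, …, f_m)`, which contains the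
adjoint system of `S`. Everything is written in the variable `s = log z` on the universal covering,
where the system has an entire fundamental matrix (`exists_entire_solution`).
* The gauge transformation in the hypothesis is only formal. A truncation of it at a high order is a
  polynomial matrix `T`, and the truncation of its inverse inverts `T` up to a high order
  (`IsRegularSingularAtZero.exists_polynomial_gauge`). The matrix `U T` then satisfies a system with
  bounded coefficients in `s`, and Grönwall's inequality bounds `U` (`exists_moderate_growth`).
* By Cayley-Hamilton, a polynomial in the translation `s ↦ s + 2πi` annihilates the entries of `U`.
  An induction on its roots `μ` puts these entries into the span of the functions
  `h(exp s) exp(α s) s^i`: on this span `v(s + 2πi) - μ v(s) = w(s)` can be solved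
  (`nilssonSpan_le_map`), and a periodic function of moderate growth is meromorphic in `exp s`
  (`exists_analytic_of_periodic`).

Finally the constant `c` depends on `f₁, …, f_m` only, since by independence these functions satisfy
only one system (`SolvesInhomogeneous.unique`).
-/

noncomputable section

namespace GradedPade

/-! ### Entire linear differential systems -/

section ODE
variable {𝔸 : Type*} [NormedRing 𝔸] [NormedAlgebra ℂ 𝔸]

/-- The Taylor coefficients of the solution of `U' = U A`, `U(0) = 1`, where `A = ∑ αₙ sⁿ`. -/
def odeCoeff (α : ℕ → 𝔸) : ℕ → 𝔸
  | 0 => 1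
  | k + 1 => ((k : ℂ) + 1)⁻¹ • ∑ i : Fin (k + 1), odeCoeff α i * α (k - i)

theorem odeCoeff_succ (α : ℕ → 𝔸) (k : ℕ) :
    ((k : ℂ) + 1) • odeCoeff α (k + 1) =
      ∑ x ∈ Finset.HasAntidiagonal.antidiagonal k, odeCoeff α x.1 * α x.2 := by
  rw [odeCoeff, smul_smul, mul_inv_cancel₀ (Nat.cast_add_one_ne_zero k), one_smul,
    Finset.Nat.sum_antidiagonal_eq_sum_range_succ_mk,
    Fin.sum_univ_eq_sum_range (fun i => odeCoeff α i * α (k - i))]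

/-- If `∑ ‖αₙ‖ rⁿ` converges then `‖odeCoeff α n‖ rⁿ` is bounded: as soon as `k + 1` exceeds
`r ∑ ‖αₙ‖ rⁿ`, the recursion does not increase the maximum of these quantities. -/
theorem exists_odeCoeff_bound (α : ℕ → 𝔸) {r : ℝ} (hr : 0 < r)
    (hα : Summable fun n => ‖α n‖ * r ^ n) :
    ∃ C : ℝ, 0 ≤ C ∧ ∀ n, ‖odeCoeff α n‖ * r ^ n ≤ C := by
  set q : ℝ := ∑' n, ‖α n‖ * r ^ n with hq
  have hq0 : 0 ≤ q := tsum_nonneg fun n => by positivity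
  obtain ⟨k₀, hk₀⟩ := exists_nat_ge (r * q)
  set C : ℝ := ∑ i ∈ Finset.range (k₀ + 1), ‖odeCoeff α i‖ * r ^ i with hC
  have hC0 : 0 ≤ C := Finset.sum_nonneg fun i _ => by positivity
  refine ⟨C, hC0, fun n => ?_⟩
  induction n using Nat.strong_induction_on with
  | _ n ih =>
    rcases Nat.lt_or_ge n (k₀ + 1) with h | h
    · exact Finset.single_le_sum (f := fun i => ‖odeCoeff α i‖ * r ^ i)
        (fun i _ => by positivity) (Finset.mem_range.2 h)
    · obtain ⟨k, rfl⟩ : ∃ k, n = k + 1 := ⟨n - 1, by omega⟩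
      have h1 : ((k : ℝ) + 1) * ‖odeCoeff α (k + 1)‖ ≤
          ∑ x ∈ Finset.HasAntidiagonal.antidiagonal k, ‖odeCoeff α x.1‖ * ‖α x.2‖ := by
        have := congrArg norm (odeCoeff_succ α k)
        rw [norm_smul] at this
        have h2 : ‖((k : ℂ) + 1)‖ = (k : ℝ) + 1 := by
          exact_mod_cast Complex.norm_natCast (k + 1)
        rw [← h2, this]
        exact (norm_sum_le _ _).trans (Finset.sum_le_sum fun x _ => norm_mul_le _ _)
      have h3 : (∑ x ∈ Finset.HasAntidiagonal.antidiagonal k, ‖odeCoeff α x.1‖ * ‖α x.2‖) * r ^ k ≤ C * q := by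
        calc _ = ∑ x ∈ Finset.HasAntidiagonal.antidiagonal k,
              (‖odeCoeff α x.1‖ * r ^ x.1) * (‖α x.2‖ * r ^ x.2) := by
              rw [Finset.sum_mul]
              refine Finset.sum_congr rfl fun x hx => ?_
              rw [← Finset.HasAntidiagonal.mem_antidiagonal.1 hx, pow_add]; ring
          _ ≤ ∑ x ∈ Finset.HasAntidiagonal.antidiagonal k, C * (‖α x.2‖ * r ^ x.2) := by
              refine Finset.sum_le_sum fun x hx => ?_
              have := Finset.HasAntidiagonal.mem_antidiagonal.1 hx
              exact mul_le_mul_of_nonneg_right (ih _ (by omega)) (by positivity)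
          _ = C * ∑ j ∈ Finset.range (k + 1), ‖α j‖ * r ^ j := by
              rw [← Finset.mul_sum, ← Finset.Nat.sum_antidiagonal_swap,
                Finset.Nat.sum_antidiagonal_eq_sum_range_succ_mk]; rfl
          _ ≤ C * q := by
              refine mul_le_mul_of_nonneg_left ?_ hC0
              exact hα.sum_le_tsum _ (fun i _ => by positivity)
      have hk : r * q ≤ (k : ℝ) + 1 := hk₀.trans (by exact_mod_cast (by omega : k₀ ≤ k + 1))
      have h4 : ((k : ℝ) + 1) * (‖odeCoeff α (k + 1)‖ * r ^ (k + 1)) ≤ ((k : ℝ) + 1) * C := by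
        calc _ = r * ((((k : ℝ) + 1) * ‖odeCoeff α (k + 1)‖) * r ^ k) := by ring
          _ ≤ r * (C * q) := by
              refine mul_le_mul_of_nonneg_left (le_trans ?_ h3) hr.le
              exact mul_le_mul_of_nonneg_right h1 (by positivity)
          _ = (r * q) * C := by ring
          _ ≤ _ := mul_le_mul_of_nonneg_right hk hC0
      exact le_of_mul_le_mul_left h4 (by positivity)

variable [CompleteSpace 𝔸]

/-- A linear differential system with entire coefficients has an entire fundamental solution. -/
theorem exists_entire_solution {A : ℂ → 𝔸} (hA : Differentiable ℂ A) :
    ∃ U : ℂ → 𝔸, U 0 = 1 ∧ ∀ s, HasDerivAt U (U s * A s) s := by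
  have hp := hA.hasFPowerSeriesOnBall 0 (R := 1) one_pos
  set p := cauchyPowerSeries A 0 (1 : NNReal) with hpdef
  set α : ℕ → 𝔸 := fun n => p.coeff n
  have hα : ∀ r : ℝ, 0 < r → Summable fun n => ‖α n‖ * r ^ n := by
    intro r hr
    have := p.summable_norm_mul_pow (r := ⟨r, hr.le⟩)
      (lt_of_lt_of_le ENNReal.coe_lt_top hp.r_le)
    simp only [FormalMultilinearSeries.norm_apply_eq_norm_coef] at this
    exact this
  have hAs : ∀ s, HasSum (fun n => s ^ n • α n) (A s) := by
    intro s
    have := hp.hasSum (y := s) (by simp)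
    simpa [FormalMultilinearSeries.apply_eq_pow_smul_coeff] using this
  clear_value α
  clear hpdef hp
  set a := odeCoeff α with ha
  have hsum : ∀ r : ℝ, 0 < r → Summable fun n : ℕ => (n : ℝ) * r ^ (n - 1) * ‖a n‖ := by
    intro r hr
    obtain ⟨C, hC0, hC⟩ := exists_odeCoeff_bound α (r := 2 * r) (by positivity) (hα _ (by positivity))
    have hgeo : Summable fun n : ℕ => ((n : ℝ) ^ 1 * (1 / 2 : ℝ) ^ n) * (C / r) :=
      Summable.mul_right (C / r)
        (summable_pow_mul_geometric_of_norm_lt_one 1 (r := (1 / 2 : ℝ)) (by norm_num))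
    refine Summable.of_nonneg_of_le (fun n => by positivity) (fun n => ?_) hgeo
    rcases n with _ | n
    · simp
    · have h1 := hC (n + 1)
      have h2 : ‖a (n + 1)‖ ≤ C / (2 * r) ^ (n + 1) := by
        rw [le_div_iff₀ (by positivity)]; exact h1
      calc _ ≤ ((n + 1 : ℕ) : ℝ) * r ^ (n + 1 - 1) * (C / (2 * r) ^ (n + 1)) := by gcongr
        _ = _ := by
          simp only [Nat.add_sub_cancel, mul_pow, one_div, inv_pow]; field_simp; ring
  have hsum' : ∀ s : ℂ, Summable fun n => ‖s ^ n • a n‖ := by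
    intro s
    obtain ⟨C, hC0, hC⟩ := exists_odeCoeff_bound α (r := 2 * (‖s‖ + 1)) (by positivity)
      (hα _ (by positivity))
    have hgeo : Summable fun n : ℕ => (1 / 2 : ℝ) ^ n * C :=
      (summable_geometric_of_lt_one (by norm_num) (by norm_num)).mul_right _
    refine Summable.of_nonneg_of_le (fun n => by positivity) (fun n => ?_) hgeo
    have h2 : ‖a n‖ ≤ C / (2 * (‖s‖ + 1)) ^ n := by
      rw [le_div_iff₀ (by positivity)]; exact hC n
    rw [norm_smul, norm_pow]
    calc _ ≤ (‖s‖ + 1) ^ n * (C / (2 * (‖s‖ + 1)) ^ n) := by gcongr; linarith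
      _ = _ := by rw [mul_pow, one_div, inv_pow]; field_simp
  refine ⟨fun s => ∑' n, s ^ n • a n, ?_, fun s => ?_⟩
  · beta_reduce
    rw [tsum_eq_single 0]
    · simp [ha, odeCoeff]
    · intro n hn; simp [hn]
  · have hder := hasDerivAt_tsum_of_isPreconnected (𝕜 := ℂ)
      (g := fun n z => z ^ n • a n) (g' := fun n z => ((n : ℂ) * z ^ (n - 1)) • a n)
      (hsum (‖s‖ + 1) (by positivity)) (Metric.isOpen_ball (x := (0 : ℂ)) (ε := ‖s‖ + 1))
      (convex_ball _ _).isPreconnected (fun n y _ => (hasDerivAt_pow n y).smul_const (a n))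
      (fun n y hy => by
        rw [norm_smul, norm_mul, norm_pow, Complex.norm_natCast]
        have : ‖y‖ ≤ ‖s‖ + 1 := by simpa using (Metric.mem_ball.1 hy).le
        gcongr)
      (Metric.mem_ball_self (by positivity)) (hsum' 0).of_norm
      (y := s) (by simp)
    convert! hder using 1
    have h1 : Summable fun n : ℕ => ((n : ℂ) * s ^ (n - 1)) • a n := by
      refine Summable.of_norm (Summable.of_nonneg_of_le (fun n => by positivity) (fun n => ?_)
        (hsum (‖s‖ + 1) (by positivity)))
      rw [norm_smul, norm_mul, norm_pow, Complex.norm_natCast]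
      gcongr; linarith
    have hα' : Summable fun n => ‖s ^ n • α n‖ := by
      refine Summable.of_nonneg_of_le (fun n => by positivity) (fun n => ?_)
        (hα (‖s‖ + 1) (by positivity))
      rw [norm_smul, norm_pow, mul_comm]
      gcongr; linarith
    rw [h1.tsum_eq_zero_add, ← (hAs s).tsum_eq,
      tsum_mul_tsum_eq_tsum_sum_antidiagonal_of_summable_norm (hsum' s) hα']
    simp only [Nat.cast_zero, zero_mul, zero_smul, zero_add, Nat.add_sub_cancel, Nat.cast_add,
      Nat.cast_one]
    refine tsum_congr fun n => ?_
    rw [mul_comm, mul_smul, odeCoeff_succ, Finset.smul_sum]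
    refine Finset.sum_congr rfl fun x hx => ?_
    rw [smul_mul_smul_comm, ← pow_add, Finset.HasAntidiagonal.mem_antidiagonal.1 hx]

end ODE

/-! ### Formal gauge transformations and their truncations -/

theorem evalLaurent_add (s t : ℚ[T;T⁻¹]) (z : ℂ) :
    evalLaurent (s + t) z = evalLaurent s z + evalLaurent t z := by
  unfold evalLaurent
  rw [AddMonoidAlgebra.coeff_add]
  exact Finsupp.sum_add_index' (by simp) (by intros; push_cast; ring)

theorem evalLaurent_single (n : ℤ) (a : ℚ) (z : ℂ) :
    evalLaurent (AddMonoidAlgebra.single n a) z = a * z ^ n := by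
  unfold evalLaurent
  rw [AddMonoidAlgebra.coeff_single]
  simp

theorem laurentToSeries_add (s t : ℚ[T;T⁻¹]) :
    laurentToSeries (s + t) = laurentToSeries s + laurentToSeries t := by
  unfold laurentToSeries
  rw [AddMonoidAlgebra.coeff_add]
  exact Finsupp.sum_add_index' (by simp) (by intros; push_cast; rw [HahnSeries.single_add])

theorem laurentToSeries_single (n : ℤ) (a : ℚ) :
    laurentToSeries (AddMonoidAlgebra.single n a) = HahnSeries.single n (a : ℂ) := by
  unfold laurentToSeries
  rw [AddMonoidAlgebra.coeff_single]
  simp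

/-- Multiplication by a high power of `z` turns a Laurent polynomial into a polynomial, both as a
function on `ℂ \ {0}` and as a formal series. -/
theorem exists_clear_laurent (s : ℚ[T;T⁻¹]) : ∃ d₀ : ℕ, ∀ d ≥ d₀, ∃ c : ℂ[X],
    (∀ z : ℂ, z ≠ 0 → z ^ d * evalLaurent s z = c.eval z) ∧
    HahnSeries.single (d : ℤ) (1 : ℂ) * laurentToSeries s =
      HahnSeries.ofPowerSeries ℤ ℂ (c : PowerSeries ℂ) := by
  induction s using LaurentPolynomial.induction_on' with
  | add p q hp hq =>
    obtain ⟨d₁, h₁⟩ := hp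
    obtain ⟨d₂, h₂⟩ := hq
    refine ⟨max d₁ d₂, fun d hd => ?_⟩
    obtain ⟨c₁, e₁, s₁⟩ := h₁ d (le_trans (le_max_left _ _) hd)
    obtain ⟨c₂, e₂, s₂⟩ := h₂ d (le_trans (le_max_right _ _) hd)
    refine ⟨c₁ + c₂, fun z hz => ?_, ?_⟩
    · rw [evalLaurent_add, mul_add, e₁ z hz, e₂ z hz, Polynomial.eval_add]
    · rw [laurentToSeries_add, mul_add, s₁, s₂, Polynomial.coe_add, map_add]
  | C_mul_T n a =>
    refine ⟨n.natAbs, fun d hd => ?_⟩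
    obtain ⟨k, hk⟩ : ∃ k : ℕ, (d : ℤ) + n = k := ⟨((d : ℤ) + n).toNat, by omega⟩
    rw [← LaurentPolynomial.single_eq_C_mul_T]
    refine ⟨Polynomial.C (a : ℂ) * Polynomial.X ^ k, fun z hz => ?_, ?_⟩
    · rw [evalLaurent_single, ← zpow_natCast, mul_left_comm, ← zpow_add₀ hz, hk]
      simp
    · rw [laurentToSeries_single, HahnSeries.single_mul_single, hk, Polynomial.coe_mul,
        Polynomial.coe_pow, Polynomial.coe_C, Polynomial.coe_X, RingHom.map_mul,
        HahnSeries.ofPowerSeries_X_pow, HahnSeries.ofPowerSeries_C, HahnSeries.C_apply,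
        HahnSeries.single_mul_single, zero_add, one_mul, mul_one]

theorem exists_clear_matrix {n : ℕ} (B : Matrix (Fin n) (Fin n) ℚ[T;T⁻¹]) :
    ∃ (d : ℕ) (C : Matrix (Fin n) (Fin n) ℂ[X]),
      (∀ z : ℂ, z ≠ 0 → ∀ i j, z ^ (d + 1) * evalLaurent (B i j) z = (C i j).eval z) ∧
      (HahnSeries.single ((d + 1 : ℕ) : ℤ) (1 : ℂ) : LaurentSeries ℂ) • B.map laurentToSeries =
        (C.map (fun q => (q : PowerSeries ℂ))).map (HahnSeries.ofPowerSeries ℤ ℂ) := by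
  choose d₀ h using fun i j => exists_clear_laurent (B i j)
  have hd : ∀ i j, d₀ i j ≤ (∑ i, ∑ j, d₀ i j) + 1 := fun i j =>
    ((Finset.single_le_sum (f := fun j => d₀ i j) (fun _ _ => Nat.zero_le _)
      (Finset.mem_univ j)).trans (Finset.single_le_sum (f := fun i => ∑ j, d₀ i j)
      (fun _ _ => Nat.zero_le _) (Finset.mem_univ i))).trans (Nat.le_succ _)
  choose C h₁ h₂ using fun i j => h i j _ (hd i j)
  refine ⟨∑ i, ∑ j, d₀ i j, Matrix.of C, fun z hz i j => h₁ i j z hz, ?_⟩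
  ext1 i j
  exact h₂ i j

theorem exists_clear_series (x : LaurentSeries ℂ) : ∃ a₀ : ℕ, ∀ a ≥ a₀, ∃ y : PowerSeries ℂ,
    HahnSeries.single (a : ℤ) (1 : ℂ) * x = HahnSeries.ofPowerSeries ℤ ℂ y := by
  refine ⟨x.order.natAbs, fun a ha => ?_⟩
  obtain ⟨k, hk⟩ : ∃ k : ℕ, (a : ℤ) + x.order = k := ⟨((a : ℤ) + x.order).toNat, by omega⟩
  refine ⟨PowerSeries.X ^ k * x.powerSeriesPart, ?_⟩
  conv_lhs => rw [← LaurentSeries.single_order_mul_powerSeriesPart x]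
  rw [← mul_assoc, HahnSeries.single_mul_single, hk, RingHom.map_mul, HahnSeries.ofPowerSeries_X_pow,
    one_mul]

theorem exists_clear_series_matrix {n : ℕ} (G : Matrix (Fin n) (Fin n) (LaurentSeries ℂ)) :
    ∃ (a : ℕ) (G' : Matrix (Fin n) (Fin n) (PowerSeries ℂ)),
      (HahnSeries.single (a : ℤ) (1 : ℂ) : LaurentSeries ℂ) • G = G'.map (HahnSeries.ofPowerSeries ℤ ℂ) := by
  choose d₀ h using fun i j => exists_clear_series (G i j)
  have hd : ∀ i j, d₀ i j ≤ ∑ i, ∑ j, d₀ i j := fun i j =>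
    ((Finset.single_le_sum (f := fun j => d₀ i j) (fun _ _ => Nat.zero_le _)
      (Finset.mem_univ j)).trans (Finset.single_le_sum (f := fun i => ∑ j, d₀ i j)
      (fun _ _ => Nat.zero_le _) (Finset.mem_univ i)))
  choose C h₁ using fun i j => h i j _ (hd i j)
  refine ⟨∑ i, ∑ j, d₀ i j, Matrix.of C, ?_⟩
  ext1 i j
  exact h₁ i j

/-- The Euler derivation `z d/dz` on `z^(-a) y`, for a power series `y`. -/
theorem single_mul_derivative {a : ℕ} {x : LaurentSeries ℂ} {y : PowerSeries ℂ}
    (h : HahnSeries.single (a : ℤ) (1 : ℂ) * x = HahnSeries.ofPowerSeries ℤ ℂ y) :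
    HahnSeries.single (a : ℤ) (1 : ℂ) *
        (HahnSeries.single (1 : ℤ) (1 : ℂ) * LaurentSeries.derivative ℂ x) =
      HahnSeries.ofPowerSeries ℤ ℂ
        (PowerSeries.X * PowerSeries.derivative ℂ y - (a : PowerSeries ℂ) * y) := by
  have hx : ∀ k : ℤ, x.coeff k = (HahnSeries.ofPowerSeries ℤ ℂ y).coeff (k + a) := by
    intro k
    rw [← h, HahnSeries.coeff_single_mul]; simp
  ext k
  rw [HahnSeries.coeff_single_mul, HahnSeries.coeff_single_mul, LaurentSeries.derivative_apply,
    LaurentSeries.hasseDeriv_coeff, hx]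
  have e : k - ↑a - 1 + ((1 : ℕ) : ℤ) + ↑a = k := by push_cast; ring
  rw [e, Ring.choose_one_right, PowerSeries.coeff_coe, PowerSeries.coeff_coe]
  by_cases hk : k < 0
  · simp [hk]
  · obtain ⟨l, rfl⟩ : ∃ l : ℕ, k = l := ⟨k.toNat, by omega⟩
    have h2 : (a : PowerSeries ℂ) = PowerSeries.C (a : ℂ) := by simp
    simp only [hk, if_false, Int.natAbs_natCast, map_sub, h2, PowerSeries.coeff_C_mul]
    rcases l with _ | l
    · simp
    · rw [PowerSeries.coeff_succ_X_mul, PowerSeries.coeff_derivative]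
      simp
      ring

/-- Truncation of a matrix of power series at order `k`. -/
theorem exists_truncation {n : ℕ} (k : ℕ) (M : Matrix (Fin n) (Fin n) (PowerSeries ℂ)) :
    ∃ (T : Matrix (Fin n) (Fin n) ℂ[X]) (R : Matrix (Fin n) (Fin n) (PowerSeries ℂ)),
      M = T.map Polynomial.coeToPowerSeries.ringHom + (PowerSeries.X ^ k : PowerSeries ℂ) • R := by
  have h : ∀ i j, ∃ r, M i j - (PowerSeries.trunc k (M i j) : PowerSeries ℂ) =
      PowerSeries.X ^ k * r := fun i j => by
    refine PowerSeries.X_pow_dvd_iff.2 fun l hl => ?_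
    rw [map_sub, Polynomial.coeff_coe, PowerSeries.coeff_trunc, if_pos hl, sub_self]
  choose R hR using h
  refine ⟨Matrix.of fun i j => PowerSeries.trunc k (M i j), Matrix.of R, ?_⟩
  ext1 i j
  simp [← hR]

theorem exists_eq_X_pow_smul {n k : ℕ} {M : Matrix (Fin n) (Fin n) ℂ[X]}
    {R : Matrix (Fin n) (Fin n) (PowerSeries ℂ)}
    (h : M.map Polynomial.coeToPowerSeries.ringHom = (PowerSeries.X ^ k : PowerSeries ℂ) • R) :
    ∃ Q : Matrix (Fin n) (Fin n) ℂ[X], M = (Polynomial.X ^ k : ℂ[X]) • Q := by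
  have h' : ∀ i j, ∃ q, M i j = Polynomial.X ^ k * q := fun i j => by
    refine Polynomial.X_pow_dvd_iff.2 fun l hl => ?_
    have := congrFun (congrFun h i) j
    simp only [Matrix.map_apply, Matrix.smul_apply, smul_eq_mul,
      Polynomial.coeToPowerSeries.ringHom_apply] at this
    rw [← Polynomial.coeff_coe, this]
    exact PowerSeries.X_pow_dvd_iff.1 (dvd_mul_right _ _) l hl
  choose Q hQ using h'
  exact ⟨Matrix.of Q, by ext1 i j; exact hQ i j⟩

/-- The product of truncations of two elements with product `x ^ p`. -/
theorem truncated_product {R 𝔸 : Type*} [CommRing R] [Ring 𝔸] [Algebra R 𝔸] (x : R) {p d : ℕ}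
    {G₁ G₂ R₁ R₂ : 𝔸} (h : G₁ * G₂ = x ^ p • 1) :
    (G₁ - x ^ (p + d + 1) • R₁) * (G₂ - x ^ (p + d + 1) • R₂) - x ^ p • 1 =
      x ^ (p + 1) • (x ^ d • (-(G₁ * R₂) - R₁ * G₂ + x ^ (p + d + 1) • (R₁ * R₂))) := by
  simp only [mul_sub, sub_mul, smul_mul_assoc, mul_smul_comm, h]
  module

/-- A system `C G - x ^ (d + 1) D + a x ^ d G = x ^ d G H`, in which `D` stands for the derivative of
`G`, after truncation of `G`, `D` and `H`. -/
theorem truncated_system {R 𝔸 : Type*} [CommRing R] [Ring 𝔸] [Algebra R 𝔸] (x a : R) {p d : ℕ}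
    {C G D H R₁ S R₃ : 𝔸} (h : C * G - x ^ d • (x • D - a • G) = x ^ d • (G * H)) :
    C * (G - x ^ (p + d + 1) • R₁) - x ^ (d + 1) • (D - x ^ (p + d) • S) +
        (a * x ^ d) • (G - x ^ (p + d + 1) • R₁) -
        x ^ d • ((G - x ^ (p + d + 1) • R₁) * (H - x ^ (p + d + 1) • R₃)) =
      x ^ (d + p) • (-(x • (C * R₁)) + x ^ (d + 1) • S - (a * x ^ (d + 1)) • R₁ +
        x ^ (d + 1) • (G * R₃ + R₁ * H - x ^ (p + d + 1) • (R₁ * R₃))) := by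
  simp only [mul_sub, sub_mul, smul_mul_assoc, mul_smul_comm, smul_sub, ← h]
  module

/-- A formal gauge transformation to a system with a simple pole, and its inverse, are replaced by
polynomial matrices `T` and `L`, at the cost of error terms `Q`, `Q'` of high order. -/
theorem IsRegularSingularAtZero.exists_polynomial_gauge {n : ℕ}
    {B : Matrix (Fin n) (Fin n) ℚ[T;T⁻¹]}
    (hB : IsRegularSingularAtZero (B.map laurentToSeries)) :
    ∃ (d p a : ℕ) (C T L H Q Q' : Matrix (Fin n) (Fin n) ℂ[X]),
      (∀ z : ℂ, z ≠ 0 → ∀ i j, z ^ (d + 1) * evalLaurent (B i j) z = (C i j).eval z) ∧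
      T * L = (Polynomial.X ^ p : ℂ[X]) • 1 + (Polynomial.X ^ (p + 1) : ℂ[X]) • Q' ∧
      C * T - (Polynomial.X ^ (d + 1) : ℂ[X]) • T.map Polynomial.derivative +
          ((a : ℂ[X]) * Polynomial.X ^ d) • T =
        (Polynomial.X ^ d : ℂ[X]) • (T * H) + (Polynomial.X ^ (d + p) : ℂ[X]) • Q := by
  obtain ⟨G, H, hG, hGH⟩ := hB
  obtain ⟨d, C, hC, hC'⟩ := exists_clear_matrix B
  obtain ⟨a, G₁, hG₁⟩ := exists_clear_series_matrix G
  obtain ⟨b, G₂, hG₂⟩ := exists_clear_series_matrix G⁻¹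
  set φ := HahnSeries.ofPowerSeries ℤ ℂ with hφ
  let ι := Polynomial.coeToPowerSeries.ringHom (R := ℂ)
  have hGH' : (HahnSeries.single (1 : ℤ) (1 : ℂ) : LaurentSeries ℂ) •
      (B.map laurentToSeries * G - G.map (LaurentSeries.derivative ℂ)) = G * H.map φ := hGH
  have hsl : ∀ (r : LaurentSeries ℂ) (M M' : Matrix (Fin n) (Fin n) (LaurentSeries ℂ)),
      (r • M) * M' = r • (M * M') := fun r M M' => Matrix.smul_mul r M M'
  have hsr : ∀ (r : LaurentSeries ℂ) (M M' : Matrix (Fin n) (Fin n) (LaurentSeries ℂ)),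
      M * (r • M') = r • (M * M') := fun r M M' => Matrix.mul_smul M r M'
  have hφi : Function.Injective fun M : Matrix (Fin n) (Fin n) (PowerSeries ℂ) => M.map φ :=
    Matrix.map_injective HahnSeries.ofPowerSeries_injective
  have hσ : ∀ k : ℕ, (HahnSeries.single (k : ℤ) (1 : ℂ)) = φ (PowerSeries.X ^ k) := fun k => by
    rw [hφ, HahnSeries.ofPowerSeries_X_pow]
  have hsm : ∀ (r : PowerSeries ℂ) (M : Matrix (Fin n) (Fin n) (PowerSeries ℂ)),
      (r • M).map φ = φ r • M.map φ := fun r M => by ext1 i j; simp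
  -- the formal system satisfied by `G₁ = z ^ a G`, free of denominators
  have hder : (HahnSeries.single (a : ℤ) (1 : ℂ) : LaurentSeries ℂ) • ((HahnSeries.single (1 : ℤ) (1 : ℂ) : LaurentSeries ℂ) •
      G.map (LaurentSeries.derivative ℂ)) =
      ((PowerSeries.X : PowerSeries ℂ) • G₁.map (PowerSeries.derivative ℂ) -
        (a : PowerSeries ℂ) • G₁).map φ := by
    ext1 i j
    exact single_mul_derivative (congrFun (congrFun hG₁ i) j)
  have hsys : C.map ι * G₁ - (PowerSeries.X ^ d : PowerSeries ℂ) •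
      ((PowerSeries.X : PowerSeries ℂ) • G₁.map (PowerSeries.derivative ℂ) -
        (a : PowerSeries ℂ) • G₁) = (PowerSeries.X ^ d : PowerSeries ℂ) • (G₁ * H) := by
    apply hφi
    beta_reduce
    rw [Matrix.map_sub φ (map_sub φ), Matrix.map_mul, hsm, hsm, ← hder, Matrix.map_mul, ← hG₁]
    have hC'' : (C.map ι).map φ = (HahnSeries.single ((d + 1 : ℕ) : ℤ) (1 : ℂ) : LaurentSeries ℂ) •
      B.map laurentToSeries := hC'.symm
    rw [hC'', ← hσ]
    have e : HahnSeries.single ((d + 1 : ℕ) : ℤ) (1 : ℂ) =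
        HahnSeries.single (d : ℤ) (1 : ℂ) * HahnSeries.single (1 : ℤ) (1 : ℂ) := by
      rw [HahnSeries.single_mul_single]; simp
    rw [hsl (HahnSeries.single (a : ℤ) (1 : ℂ) : LaurentSeries ℂ) G, ← hGH', e]
    simp only [hsl, hsr, smul_sub, smul_smul]
    congr 2; ring
  have hinv : G₁ * G₂ = (PowerSeries.X ^ (a + b) : PowerSeries ℂ) • 1 := by
    apply hφi
    beta_reduce
    rw [Matrix.map_mul, ← hG₁, ← hG₂, hsm, hsl, hsr,
      Matrix.mul_nonsing_inv _ hG, smul_smul, hσ, hσ, ← map_mul, ← pow_add,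
      Matrix.map_one φ (map_zero φ) (map_one φ)]
  set p := a + b with hp
  obtain ⟨T, R₁, hT⟩ := exists_truncation (p + d + 1) G₁
  obtain ⟨L, R₂, hL⟩ := exists_truncation (p + d + 1) G₂
  obtain ⟨H₀, R₃, hH₀⟩ := exists_truncation (p + d + 1) H
  have hιX : ι Polynomial.X = PowerSeries.X := Polynomial.coe_X
  have hsmι : ∀ (r : ℂ[X]) (M : Matrix (Fin n) (Fin n) ℂ[X]),
      (r • M).map ι = ι r • M.map ι := fun r M => by ext1 i j; simp
  have hTeq : T.map ι = G₁ - (PowerSeries.X ^ (p + d + 1) : PowerSeries ℂ) • R₁ := by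
    rw [hT, add_sub_cancel_right]
  have hLeq : L.map ι = G₂ - (PowerSeries.X ^ (p + d + 1) : PowerSeries ℂ) • R₂ := by
    rw [hL, add_sub_cancel_right]
  have hHeq : H₀.map ι = H - (PowerSeries.X ^ (p + d + 1) : PowerSeries ℂ) • R₃ := by
    rw [hH₀, add_sub_cancel_right]
  have hdT : (T.map Polynomial.derivative).map ι = G₁.map (PowerSeries.derivative ℂ) -
      (PowerSeries.X ^ (p + d) : PowerSeries ℂ) • (((p + d + 1 : ℕ) : PowerSeries ℂ) • R₁ +
        (PowerSeries.X : PowerSeries ℂ) • R₁.map (PowerSeries.derivative ℂ)) := by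
    ext1 i j
    have h1 := congrArg (PowerSeries.derivative ℂ) (congrFun (congrFun hTeq i) j)
    simp only [Matrix.map_apply, Matrix.sub_apply, Matrix.smul_apply, smul_eq_mul, map_sub,
      Matrix.add_apply] at h1 ⊢
    have h2 : PowerSeries.derivative ℂ (ι (T i j)) = ι (Polynomial.derivative (T i j)) :=
      PowerSeries.derivative_coe _
    rw [← h2, h1, Derivation.leibniz, Derivation.leibniz_pow, PowerSeries.derivative_X]
    simp only [smul_eq_mul, nsmul_eq_mul, Nat.add_sub_cancel]
    ring
  have e1 : (T * L - (Polynomial.X ^ p : ℂ[X]) • 1).map ι =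
      (PowerSeries.X ^ (p + 1) : PowerSeries ℂ) • ((PowerSeries.X ^ d : PowerSeries ℂ) •
        (-(G₁ * R₂) - R₁ * G₂ + (PowerSeries.X ^ (p + d + 1) : PowerSeries ℂ) • (R₁ * R₂))) := by
    rw [Matrix.map_sub ι (map_sub ι), Matrix.map_mul, hTeq, hLeq, hsmι,
      Matrix.map_one ι (map_zero ι) (map_one ι), map_pow, hιX]
    exact truncated_product _ hinv
  have e2 : (C * T - (Polynomial.X ^ (d + 1) : ℂ[X]) • T.map Polynomial.derivative +
          ((a : ℂ[X]) * Polynomial.X ^ d) • T - (Polynomial.X ^ d : ℂ[X]) • (T * H₀)).map ι =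
      (PowerSeries.X ^ (d + p) : PowerSeries ℂ) • (
        -((PowerSeries.X : PowerSeries ℂ) • (C.map ι * R₁)) +
        (PowerSeries.X ^ (d + 1) : PowerSeries ℂ) • (((p + d + 1 : ℕ) : PowerSeries ℂ) • R₁ +
        (PowerSeries.X : PowerSeries ℂ) • R₁.map (PowerSeries.derivative ℂ)) -
        ((a : PowerSeries ℂ) * PowerSeries.X ^ (d + 1)) • R₁ +
        (PowerSeries.X ^ (d + 1) : PowerSeries ℂ) • (G₁ * R₃ + R₁ * H -
          (PowerSeries.X ^ (p + d + 1) : PowerSeries ℂ) • (R₁ * R₃))) := by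
    rw [Matrix.map_sub ι (map_sub ι), Matrix.map_add ι (map_add ι), Matrix.map_sub ι (map_sub ι),
      hsmι, hsmι, hsmι, Matrix.map_mul, Matrix.map_mul, hdT, hTeq, hHeq, map_mul, map_pow, map_pow,
      hιX, map_natCast]
    exact truncated_system _ _ hsys
  obtain ⟨Q', hQ'⟩ := exists_eq_X_pow_smul e1
  obtain ⟨Q, hQ⟩ := exists_eq_X_pow_smul e2
  exact ⟨d, p, a, C, T, L, H₀, Q, Q', hC, by rw [← hQ']; abel, by rw [← hQ]; abel⟩

/-! ### Moderate growth and monodromy -/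

section Growth
variable {𝔸 : Type*} [NormedRing 𝔸] [NormedAlgebra ℂ 𝔸]

/-- Grönwall's inequality on horizontal half-lines going to the left. -/
theorem norm_le_of_horizontal {W E : ℂ → 𝔸} {x₀ K : ℝ}
    (hW : ∀ s : ℂ, s.re ≤ x₀ → HasDerivAt W (W s * E s) s)
    (hE : ∀ s : ℂ, s.re ≤ x₀ → ‖E s‖ ≤ K) {s : ℂ} (hs : s.re ≤ x₀) :
    ‖W s‖ ≤ ‖W (x₀ + s.im * Complex.I)‖ * Real.exp (K * (x₀ - s.re)) := by
  set s₀ : ℂ := x₀ + s.im * Complex.I with hs₀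
  have hre : ∀ t : ℝ, (s₀ - t).re = x₀ - t := fun t => by simp [hs₀]
  have hder : ∀ t : ℝ, 0 ≤ t →
      HasDerivAt (fun t : ℝ => W (s₀ - t)) (-(W (s₀ - t) * E (s₀ - t))) t := by
    intro t ht
    have h1 := hW (s₀ - t) (by rw [hre]; linarith)
    have h2 : HasDerivAt (fun t : ℝ => s₀ - (t : ℂ)) (-1) t :=
      (Complex.ofRealCLM.hasDerivAt (x := t)).const_sub s₀
    have := h1.scomp t h2
    simpa [Function.comp_def] using this
  have key := norm_le_gronwallBound_of_norm_deriv_right_le (E := 𝔸)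
    (f := fun t : ℝ => W (s₀ - t)) (f' := fun t => -(W (s₀ - t) * E (s₀ - t)))
    (δ := ‖W s₀‖) (K := K) (ε := 0) (a := 0) (b := x₀ - s.re)
    (fun t ht => (hder t ht.1).continuousAt.continuousWithinAt)
    (fun t ht => (hder t ht.1).hasDerivWithinAt) (by simp)
    (fun t ht => by
      rw [norm_neg, add_zero, mul_comm K]
      refine (norm_mul_le _ _).trans (mul_le_mul_of_nonneg_left (hE _ ?_) (norm_nonneg _))
      rw [hre]; linarith [ht.1]) (x₀ - s.re) ⟨by linarith, le_rfl⟩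
  have e : s₀ - ((x₀ - s.re : ℝ) : ℂ) = s := by
    rw [hs₀]; push_cast; linear_combination Complex.re_add_im s
  simp only [e, gronwallBound_ε0, sub_zero] at key
  exact key

variable [CompleteSpace 𝔸]

/-- Solutions of a system which an approximate gauge transformation `T`, with approximate inverse
`L`, brings to a simple pole have moderate growth at `0` (here `z = exp s`). -/
theorem exists_moderate_growth {A U C T T' L H Q Q' : ℂ → 𝔸} {d p a : ℕ}
    (hU : ∀ s, HasDerivAt U (-(U s * A s)) s)
    (hA : ∀ s, Complex.exp s ^ d • A s = C (Complex.exp s))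
    (hT : ∀ z, HasDerivAt T (T' z) z) (hL : Continuous L) (hH : Continuous H)
    (hQ : Continuous Q) (hQ' : Continuous Q')
    (h₁ : ∀ z, T z * L z = z ^ p • 1 + z ^ (p + 1) • Q' z)
    (h₂ : ∀ z, C z * T z - z ^ (d + 1) • T' z + ((a : ℂ) * z ^ d) • T z =
      z ^ d • (T z * H z) + z ^ (d + p) • Q z) :
    ∃ c : ℝ, 0 ≤ c ∧ ∃ x₀ : ℝ, ∀ b : ℝ, ∃ K : ℝ, ∀ s : ℂ, s.re ≤ x₀ → |s.im| ≤ b →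
      ‖U s‖ ≤ K * Real.exp (-(c * s.re)) := by
  set J : ℂ → 𝔸 := fun z => Ring.inverse (1 + z • Q' z) with hJ
  have hu : Continuous fun z : ℂ => (1 : 𝔸) + z • Q' z := by fun_prop
  have hJc : ContinuousAt J 0 := by
    have := NormedRing.inverse_continuousAt (1 : 𝔸ˣ)
    refine ContinuousAt.comp (g := Ring.inverse) ?_ hu.continuousAt
    simpa using this
  have hunit : ∀ᶠ z in 𝓝 (0 : ℂ), IsUnit ((1 : 𝔸) + z • Q' z) := by
    have : {x : 𝔸 | IsUnit x} ∈ 𝓝 ((1 : 𝔸) + (0 : ℂ) • Q' 0) := by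
      simpa using Units.nhds (1 : 𝔸ˣ)
    exact hu.continuousAt.eventually this
  -- the coefficient matrix of the system satisfied by `W = U T`
  set E : ℂ → 𝔸 := fun z => (a : ℂ) • (1 : 𝔸) - H z - L z * J z * Q z with hE
  have hLJ : ContinuousAt (fun z => L z * J z) 0 := hL.continuousAt.mul hJc
  have hEc : ContinuousAt E 0 :=
    (continuousAt_const.sub hH.continuousAt).sub (hLJ.mul hQ.continuousAt)
  have hb := (hunit.and ((hEc.norm.eventually (gt_mem_nhds (lt_add_one ‖E 0‖))).and
    (hLJ.norm.eventually (gt_mem_nhds (lt_add_one ‖L 0 * J 0‖)))))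
  obtain ⟨δ, hδ, hball⟩ := Metric.eventually_nhds_iff.1 hb
  set K₀ := ‖E 0‖ + 1 with hK₀
  set K₂ := ‖L 0 * J 0‖ + 1 with hK₂
  have hK₀0 : 0 ≤ K₀ := by positivity
  set x₀ : ℝ := Real.log δ - 1 with hx₀
  have hsmall : ∀ s : ℂ, s.re ≤ x₀ → IsUnit ((1 : 𝔸) + Complex.exp s • Q' (Complex.exp s)) ∧
      ‖E (Complex.exp s)‖ ≤ K₀ ∧ ‖L (Complex.exp s) * J (Complex.exp s)‖ ≤ K₂ := by
    intro s hs
    have : dist (Complex.exp s) 0 < δ := by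
      rw [dist_zero_right, Complex.norm_exp, ← Real.lt_log_iff_exp_lt hδ]; linarith
    obtain ⟨h1, h2, h3⟩ := hball this
    exact ⟨h1, h2.le, h3.le⟩
  set W : ℂ → 𝔸 := fun s => U s * T (Complex.exp s) with hW
  -- `U` is recovered from `W`, up to a power of `z`
  have hrec : ∀ s : ℂ, s.re ≤ x₀ →
      Complex.exp s ^ p • U s = W s * (L (Complex.exp s) * J (Complex.exp s)) := by
    intro s hs
    have h1 : W s * L (Complex.exp s) = (Complex.exp s ^ p • U s) *
        (1 + Complex.exp s • Q' (Complex.exp s)) := by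
      simp only [hW, mul_assoc, h₁]
      simp only [mul_add, mul_smul_comm, smul_mul_assoc, mul_one, smul_smul, pow_succ]
      rw [mul_comm (Complex.exp s) (Complex.exp s ^ p)]
    rw [← mul_assoc, h1, mul_assoc, Ring.mul_inverse_cancel _ (hsmall s hs).1, mul_one]
  have hWder : ∀ s : ℂ, s.re ≤ x₀ → HasDerivAt W (W s * E (Complex.exp s)) s := by
    intro s hs
    set z := Complex.exp s with hz
    have hz0 : z ≠ 0 := Complex.exp_ne_zero s
    have h1 : HasDerivAt (fun s => T (Complex.exp s)) (z • T' z) s :=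
      (hT z).scomp s (Complex.hasDerivAt_exp s)
    have h2 := (hU s).mul h1
    convert! h2 using 1
    have h3 : z ^ d • (W s * E z) = z ^ d • (-(U s * A s) * T z + U s * z • T' z) := by
      have e1 : z ^ d • (-(U s * A s) * T z + U s * z • T' z) =
          U s * (-(C z * T z) + z ^ (d + 1) • T' z) := by
        rw [← hA s]
        simp only [mul_add, mul_neg, neg_mul, smul_mul_assoc, mul_smul_comm, smul_add, smul_neg,
          mul_assoc, smul_smul, pow_succ]
        rfl
      have e2 : -(C z * T z) + z ^ (d + 1) • T' z = ((a : ℂ) * z ^ d) • T z -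
          z ^ d • (T z * H z) - z ^ (d + p) • Q z := by
        have := h₂ z
        rw [sub_sub, ← this]; abel
      have e3 : W s * E z = (a : ℂ) • W s - W s * H z - z ^ p • (U s * Q z) := by
        have h6 : z ^ p • (U s * Q z) = W s * (L z * J z) * Q z := by
          rw [← smul_mul_assoc]
          exact congrArg (· * Q z) (hrec s hs)
        rw [h6]
        simp only [hE, mul_sub, mul_smul_comm, mul_one, mul_assoc]
      rw [e1, e2, e3]
      simp only [hW, mul_sub, smul_sub, mul_smul_comm, smul_smul, pow_add, mul_assoc]
      rw [mul_comm (z ^ d)]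
    exact smul_right_injective 𝔸 (pow_ne_zero d hz0) h3
  refine ⟨p + K₀, by positivity, x₀, fun b => ?_⟩
  have hWcont : Continuous fun y : ℝ => W (x₀ + y * Complex.I) := by
    have hUc : Continuous U := continuous_iff_continuousAt.2 fun s => (hU s).continuousAt
    have hTc : Continuous T := continuous_iff_continuousAt.2 fun s => (hT s).continuousAt
    simp only [hW]
    fun_prop
  obtain ⟨K₁, hK₁⟩ := (isCompact_Icc (a := -b) (b := b)).exists_bound_of_continuousOn
    hWcont.continuousOn
  refine ⟨K₁ * Real.exp (K₀ * x₀) * K₂, fun s hs hsb => ?_⟩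
  have h1 := norm_le_of_horizontal (E := fun s => E (Complex.exp s)) hWder
    (fun s hs => (hsmall s hs).2.1) hs
  have h2 := hK₁ s.im (abs_le.1 hsb)
  have h3 := congrArg norm (hrec s hs)
  rw [norm_smul, norm_pow, Complex.norm_exp, ← Real.exp_nat_mul] at h3
  have h4 : Real.exp (p * s.re) * ‖U s‖ ≤
      K₁ * Real.exp (K₀ * (x₀ - s.re)) * K₂ := by
    rw [h3]
    refine (norm_mul_le _ _).trans (mul_le_mul ?_ (hsmall s hs).2.2 (norm_nonneg _) ?_)
    · exact h1.trans (mul_le_mul_of_nonneg_right h2 (Real.exp_pos _).le)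
    · exact mul_nonneg ((norm_nonneg _).trans h2) (Real.exp_pos _).le
  have h5 : ‖U s‖ = Real.exp (-(p * s.re)) * (Real.exp (p * s.re) * ‖U s‖) := by
    rw [← mul_assoc, ← Real.exp_add]; simp
  rw [h5]
  refine (mul_le_mul_of_nonneg_left h4 (Real.exp_pos _).le).trans (le_of_eq ?_)
  have e1 : Real.exp (-((p + K₀) * s.re)) = Real.exp (-(p * s.re)) * Real.exp (-(K₀ * s.re)) := by
    rw [← Real.exp_add]; congr 1; ring
  have e2 : Real.exp (K₀ * (x₀ - s.re)) = Real.exp (K₀ * x₀) * Real.exp (-(K₀ * s.re)) := by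
    rw [← Real.exp_add]; congr 1; ring
  rw [e1, e2]; ring

/-- The fundamental matrix of a system with `τ`-periodic coefficients is multiplied by a constant
invertible matrix under translation by `τ`. -/
theorem exists_monodromy [IsDedekindFiniteMonoid 𝔸] {A U : ℂ → 𝔸} {τ : ℂ} (hA : Differentiable ℂ A)
    (hAτ : ∀ s, A (s + τ) = A s) (hU : ∀ s, HasDerivAt U (-(U s * A s)) s) (hU0 : U 0 = 1) :
    ∃ M : 𝔸, IsUnit M ∧ ∀ s, U (s + τ) = M * U s := by
  -- the inverse of `U` is the solution `V` of `V' = A V`, `V(0) = 1`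
  obtain ⟨V', hV'0, hV'⟩ := exists_entire_solution (𝔸 := 𝔸ᵐᵒᵖ) (A := fun s => MulOpposite.op (A s))
    ((MulOpposite.opContinuousLinearEquiv ℂ : 𝔸 ≃L[ℂ] 𝔸ᵐᵒᵖ).differentiable.comp hA)
  set V : ℂ → 𝔸 := fun s => (V' s).unop with hVdef
  have hV0 : V 0 = 1 := by simp [hVdef, hV'0]
  have hV : ∀ s, HasDerivAt V (A s * V s) s := fun s =>
    ((MulOpposite.opContinuousLinearEquiv ℂ : 𝔸 ≃L[ℂ] 𝔸ᵐᵒᵖ).symm.hasFDerivAt.comp_hasDerivAt s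
      (hV' s))
  have hconst : ∀ σ : ℂ, (∀ s, A (s + σ) = A s) → ∀ s, U (s + σ) * V s = U σ := by
    intro σ hσ s
    have hd : ∀ s, HasDerivAt (fun s => U (s + σ) * V s) 0 s := by
      intro s
      have := ((hU (s + σ)).comp_add_const s σ).mul (hV s)
      convert! this using 1
      rw [hσ]; noncomm_ring
    have := is_const_of_deriv_eq_zero (fun s => (hd s).differentiableAt) (fun s => (hd s).deriv) s 0
    simpa [hV0] using this
  have hUV : ∀ s, U s * V s = 1 := fun s => by simpa [hU0] using hconst 0 (by simp) s
  have hVU : ∀ s, V s * U s = 1 := fun s => mul_eq_one_symm (hUV s)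
  refine ⟨U τ, IsUnit.of_mul_eq_one (V τ) (hUV τ), fun s => ?_⟩
  rw [← hconst τ hAτ s, mul_assoc, hVU, mul_one]

end Growth

/-! ### The Nilsson class on the universal covering -/

section NilssonClass
open Filter Complex

/-- The left end of the strip `|Im s| ≤ b`: under `z = exp s` it becomes a sectorial neighbourhood
of `0`. -/
def stripLeft (b : ℝ) : Filter ℂ := comap re atBot ⊓ 𝓟 {s | |s.im| ≤ b}

/-- Moderate growth at the left end of every horizontal strip. -/
def IsModerate (w : ℂ → ℂ) : Prop :=
  ∀ b : ℝ, ∃ c : ℝ, w =O[stripLeft b] fun s => Real.exp (-(c * s.re))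

/-- The Nilsson class at `0`, in the variable `s = log z`: linear combinations of the functions
`h(exp s) exp(α s) s ^ i` with `h` holomorphic at `0`. -/
def nilssonSpan : Submodule ℂ (ℂ → ℂ) :=
  Submodule.span ℂ {g | ∃ (h : ℂ → ℂ) (α : ℂ) (i : ℕ), AnalyticAt ℂ h 0 ∧
    g = fun s => h (exp s) * exp (α * s) * s ^ i}

/-- The translation `s ↦ s + 2πi`, that is, the monodromy around `0`. -/
def monodromyShift : Module.End ℂ (ℂ → ℂ) :=
  LinearMap.funLeft ℂ ℂ fun s : ℂ => s + 2 * Real.pi * I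

theorem monodromyShift_apply (w : ℂ → ℂ) (s : ℂ) :
    monodromyShift w s = w (s + 2 * Real.pi * I) := rfl

theorem exp_add_two_pi (s : ℂ) : exp (s + 2 * Real.pi * I) = exp s := exp_periodic s

theorem tendsto_exp_stripLeft (b : ℝ) : Tendsto exp (stripLeft b) (𝓝 0) :=
  tendsto_exp_comap_re_atBot.mono_left inf_le_left

theorem eventually_re_le (b x : ℝ) : ∀ᶠ s in stripLeft b, s.re ≤ x :=
  (tendsto_comap.eventually (eventually_le_atBot x)).filter_mono inf_le_left

theorem eventually_im_le (b : ℝ) : ∀ᶠ s in stripLeft b, |s.im| ≤ b :=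
  (eventually_principal.2 fun _ h => h : ∀ᶠ s in 𝓟 {s : ℂ | |s.im| ≤ b}, |s.im| ≤ b).filter_mono
    inf_le_right

theorem isBigO_exp_of_le {b c c' : ℝ} (h : c ≤ c') :
    (fun s : ℂ => Real.exp (-(c * s.re))) =O[stripLeft b] fun s => Real.exp (-(c' * s.re)) := by
  refine Asymptotics.IsBigO.of_bound 1 ?_
  filter_upwards [eventually_re_le b 0] with s hs
  rw [one_mul, Real.norm_of_nonneg (Real.exp_pos _).le, Real.norm_of_nonneg (Real.exp_pos _).le]
  exact Real.exp_le_exp.2 (by nlinarith)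

theorem IsModerate.add {w v : ℂ → ℂ} (hw : IsModerate w) (hv : IsModerate v) :
    IsModerate (w + v) := fun b => by
  obtain ⟨c, hc⟩ := hw b
  obtain ⟨c', hc'⟩ := hv b
  exact ⟨max c c', (hc.trans (isBigO_exp_of_le (le_max_left _ _))).add
    (hc'.trans (isBigO_exp_of_le (le_max_right _ _)))⟩

theorem IsModerate.mul {w v : ℂ → ℂ} (hw : IsModerate w) (hv : IsModerate v) :
    IsModerate (w * v) := fun b => by
  obtain ⟨c, hc⟩ := hw b
  obtain ⟨c', hc'⟩ := hv b
  refine ⟨c + c', (hc.mul hc').trans (Asymptotics.isBigO_of_le _ fun s => le_of_eq ?_)⟩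
  rw [← Real.exp_add]; congr 2; ring

theorem IsModerate.smul {w : ℂ → ℂ} (a : ℂ) (hw : IsModerate w) : IsModerate (a • w) := fun b => by
  obtain ⟨c, hc⟩ := hw b
  exact ⟨c, hc.const_smul_left a⟩

theorem IsModerate.shift {w : ℂ → ℂ} (hw : IsModerate w) : IsModerate (monodromyShift w) :=
  fun b => by
  obtain ⟨c, hc⟩ := hw (b + 2 * Real.pi)
  have ht : Tendsto (fun s : ℂ => s + 2 * Real.pi * I) (stripLeft b)
      (stripLeft (b + 2 * Real.pi)) := by
    refine tendsto_inf.2 ⟨tendsto_comap_iff.2 ?_, tendsto_principal.2 ?_⟩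
    · have : Tendsto re (stripLeft b) atBot := tendsto_comap.mono_left inf_le_left
      convert! this using 1
      ext s; simp
    · filter_upwards [eventually_im_le b] with s hs
      have : (s + 2 * Real.pi * I).im = s.im + 2 * Real.pi := by simp
      rw [this]
      refine (abs_add_le _ _).trans ?_
      rw [abs_of_pos (by positivity : (0 : ℝ) < 2 * Real.pi)]
      linarith
  refine ⟨c, ?_⟩
  have := hc.comp_tendsto ht
  convert! this using 1
  ext s
  simp

theorem isModerate_exp (α : ℂ) : IsModerate fun s => exp (α * s) := fun b => by
  refine ⟨-α.re, Asymptotics.IsBigO.of_bound (Real.exp (|α.im| * b)) ?_⟩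
  filter_upwards [eventually_im_le b] with s hs
  rw [norm_exp, Real.norm_of_nonneg (Real.exp_pos _).le, ← Real.exp_add, mul_re]
  refine Real.exp_le_exp.2 ?_
  have h1 : -(α.im * s.im) ≤ |α.im| * |s.im| := by rw [← abs_mul]; exact neg_le_abs _
  have h2 := mul_le_mul_of_nonneg_left hs (abs_nonneg α.im)
  linarith

theorem isModerate_id : IsModerate fun s => s := fun b => by
  refine ⟨1, Asymptotics.IsBigO.of_bound (1 + |b|) ?_⟩
  filter_upwards [eventually_im_le b, eventually_re_le b 0] with s hs hs'
  rw [Real.norm_of_nonneg (Real.exp_pos _).le]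
  have h1 := norm_le_abs_re_add_abs_im s
  have h2 := Real.add_one_le_exp (-(1 * s.re))
  rw [abs_of_nonpos hs'] at h1
  have h3 : |b| * 1 ≤ |b| * Real.exp (-(1 * s.re)) :=
    mul_le_mul_of_nonneg_left (by linarith) (abs_nonneg b)
  linarith [le_abs_self b]

theorem isModerate_one : IsModerate 1 := fun b =>
  ⟨0, Asymptotics.IsBigO.of_bound 1 (by simp)⟩

theorem isModerate_analytic {h : ℂ → ℂ} (hh : AnalyticAt ℂ h 0) :
    IsModerate fun s => h (exp s) := fun b => by
  refine ⟨0, ?_⟩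
  have := (hh.continuousAt.tendsto.comp (tendsto_exp_stripLeft b)).isBigO_one ℝ
  simpa [Function.comp_def] using this

theorem isModerate_pow (i : ℕ) : IsModerate fun s => s ^ i := by
  induction i with
  | zero =>
    simp only [pow_zero]
    exact isModerate_one
  | succ i ih =>
    simp only [pow_succ]
    exact ih.mul isModerate_id

theorem isModerate_of_mem {w : ℂ → ℂ} (hw : w ∈ nilssonSpan) : IsModerate w := by
  refine Submodule.span_induction (p := fun w _ => IsModerate w) ?_ ?_ ?_ ?_ hw
  · rintro _ ⟨h, α, i, hh, rfl⟩
    exact ((isModerate_analytic hh).mul (isModerate_exp α)).mul (isModerate_pow i)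
  · simpa using isModerate_one.smul 0
  · exact fun _ _ _ _ h h' => h.add h'
  · exact fun a _ _ h => h.smul a

theorem eventually_differentiableAt_of_mem {w : ℂ → ℂ} (hw : w ∈ nilssonSpan) :
    ∀ᶠ s in comap re atBot, DifferentiableAt ℂ w s := by
  refine Submodule.span_induction
    (p := fun w _ => ∀ᶠ s in comap re atBot, DifferentiableAt ℂ w s) ?_ ?_ ?_ ?_ hw
  · rintro _ ⟨h, α, i, hh, rfl⟩
    filter_upwards [tendsto_exp_comap_re_atBot.eventually hh.eventually_analyticAt] with s hs
    have : DifferentiableAt ℂ (fun s => h (exp s)) s :=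
      hs.differentiableAt.comp s differentiableAt_exp
    fun_prop
  · exact Eventually.of_forall fun s => differentiableAt_const _
  · exact fun _ _ _ _ h h' => (h.and h').mono fun s hs => hs.1.add hs.2
  · exact fun a _ _ h => h.mono fun s hs => hs.const_smul a

theorem generator_mem {h : ℂ → ℂ} (hh : AnalyticAt ℂ h 0) (α : ℂ) (i : ℕ) :
    (fun s => h (exp s) * exp (α * s) * s ^ i) ∈ nilssonSpan :=
  Submodule.subset_span ⟨h, α, i, hh, rfl⟩

theorem analytic_mem {h : ℂ → ℂ} (hh : AnalyticAt ℂ h 0) :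
    (fun s => h (exp s)) ∈ nilssonSpan := by
  simpa using generator_mem hh 0 0

theorem mul_mem_nilssonSpan {w v : ℂ → ℂ} (hw : w ∈ nilssonSpan) (hv : v ∈ nilssonSpan) :
    w * v ∈ nilssonSpan := by
  have : w * v ∈ nilssonSpan * nilssonSpan := Submodule.mul_mem_mul hw hv
  refine Submodule.mul_le.2 (fun a ha b hb => ?_) this
  have key : nilssonSpan * nilssonSpan ≤ nilssonSpan := by
    unfold nilssonSpan
    rw [Submodule.span_mul_span]
    refine Submodule.span_mono ?_
    rintro _ ⟨_, ⟨h, α, i, hh, rfl⟩, _, ⟨h', α', i', hh', rfl⟩, rfl⟩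
    refine ⟨h * h', α + α', i + i', hh.mul hh', ?_⟩
    ext s
    simp only [Pi.mul_apply, add_mul, exp_add, pow_add]
    ring
  exact key (Submodule.mul_mem_mul ha hb)

/-- An operator `f` which is triangular on `E₀, E₁, …`, with diagonal entries `ν ≠ 0` and non-zero
entries next to the diagonal: the `Eᵢ` lie in the image of `f - μ` for every `μ`. -/
theorem mem_map_sub_of_triangular {V : Type*} [AddCommGroup V] [Module ℂ V] {f : Module.End ℂ V}
    {E : ℕ → V} {a : ℕ → ℕ → ℂ} {ν : ℂ} (hν : ν ≠ 0)
    (hf : ∀ i, f (E i) = ν • ∑ j ∈ Finset.range (i + 1), a i j • E j)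
    (ha : ∀ i, a i i = 1) (ha' : ∀ i, a (i + 1) i ≠ 0) {N : Submodule ℂ V} (hE : ∀ i, E i ∈ N)
    (μ : ℂ) (i : ℕ) : E i ∈ N.map (f - μ • (1 : Module.End ℂ V)) := by
  induction i using Nat.strong_induction_on with
  | _ i ih =>
    have hlow : ∀ b : ℕ → ℂ, ∑ j ∈ Finset.range i, b j • E j ∈
        N.map (f - μ • (1 : Module.End ℂ V)) := fun b =>
      Submodule.sum_mem _ fun j hj => Submodule.smul_mem _ _ (ih j (Finset.mem_range.1 hj))
    by_cases h : ν = μ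
    · have h1 : (f - μ • (1 : Module.End ℂ V)) (E (i + 1)) =
          (ν * a (i + 1) i) • E i + ν • ∑ j ∈ Finset.range i, a (i + 1) j • E j := by
        simp only [LinearMap.sub_apply, LinearMap.smul_apply, Module.End.one_apply, hf,
          Finset.sum_range_succ _ (i + 1), Finset.sum_range_succ _ i, ha, ← h]
        module
      have h2 : (ν * a (i + 1) i) • E i ∈ N.map (f - μ • (1 : Module.End ℂ V)) := by
        have := Submodule.mem_map_of_mem (f := f - μ • (1 : Module.End ℂ V)) (hE (i + 1))
        rw [h1] at this
        exact (Submodule.add_mem_iff_left _ (Submodule.smul_mem _ _ (hlow _))).1 this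
      exact (Submodule.smul_mem_iff _ (mul_ne_zero hν (ha' i))).1 h2
    · have h1 : (f - μ • (1 : Module.End ℂ V)) (E i) =
          (ν - μ) • E i + ν • ∑ j ∈ Finset.range i, a i j • E j := by
        simp only [LinearMap.sub_apply, LinearMap.smul_apply, Module.End.one_apply, hf,
          Finset.sum_range_succ _ i, ha]
        module
      have h2 : (ν - μ) • E i ∈ N.map (f - μ • (1 : Module.End ℂ V)) := by
        have := Submodule.mem_map_of_mem (f := f - μ • (1 : Module.End ℂ V)) (hE i)
        rw [h1] at this
        exact (Submodule.add_mem_iff_left _ (Submodule.smul_mem _ _ (hlow _))).1 this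
      exact (Submodule.smul_mem_iff _ (sub_ne_zero.2 h)).1 h2

/-- The equation `v(s + 2πi) - μ v(s) = w(s)` can be solved inside the Nilsson class. -/
theorem nilssonSpan_le_map (μ : ℂ) :
    nilssonSpan ≤ nilssonSpan.map (monodromyShift - μ • (1 : Module.End ℂ (ℂ → ℂ))) := by
  conv_lhs => unfold nilssonSpan
  rw [Submodule.span_le]
  rintro _ ⟨h, α, i, hh, rfl⟩
  refine mem_map_sub_of_triangular (f := monodromyShift)
    (E := fun i s => h (exp s) * exp (α * s) * s ^ i)
    (a := fun i j => (2 * Real.pi * I) ^ (i - j) * (i.choose j : ℂ))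
    (ν := exp (α * (2 * Real.pi * I))) (exp_ne_zero _) (fun i => ?_) (fun i => by simp)
    (fun i => ?_) (generator_mem hh α) μ i
  · ext s
    simp only [monodromyShift_apply, Pi.smul_apply, Finset.sum_apply, smul_eq_mul, exp_add_two_pi]
    simp only [mul_add, exp_add, add_pow, Finset.mul_sum]
    exact Finset.sum_congr rfl fun j _ => by ring
  · have : ((i + 1).choose i : ℂ) ≠ 0 := by
      rw [Nat.choose_succ_self_right]; exact_mod_cast Nat.succ_ne_zero i
    exact mul_ne_zero (pow_ne_zero _ two_pi_I_ne_zero) this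

/-- A `2πi`-periodic function of moderate growth is a meromorphic function of `exp s`. -/
theorem exists_analytic_of_periodic {g : ℂ → ℂ} (hp : ∀ s, g (s + 2 * Real.pi * I) = g s)
    (hd : ∀ᶠ s in comap re atBot, DifferentiableAt ℂ g s) (hm : IsModerate g) :
    ∃ (h : ℂ → ℂ) (α : ℂ), AnalyticAt ℂ h 0 ∧ ∀ s, g s = h (exp s) * exp (α * s) := by
  -- a power of `exp s` makes the function bounded, and singularities are removed in `exp s`
  obtain ⟨c, hc⟩ := hm Real.pi
  obtain ⟨k, hk⟩ := exists_nat_ge c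
  set G : ℂ → ℂ := fun s => g s * exp (k * s) with hG
  have hGp : Function.Periodic G (2 * Real.pi * I) := fun s => by
    have : exp (k * (s + 2 * Real.pi * I)) = exp (k * s) := by
      rw [mul_add, exp_add, exp_nat_mul_two_pi_mul_I, mul_one]
    simp only [hG, hp, this]
  have hGd : ∀ᶠ s in comap re atBot, DifferentiableAt ℂ G s := hd.mono fun s hs => by
    simp only [hG]; fun_prop
  -- bounded on the strip, hence on the half-plane by periodicity
  have hGb : G =O[comap re atBot] (1 : ℂ → ℝ) := by
    have h1 : G =O[stripLeft Real.pi] (1 : ℂ → ℝ) := by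
      have h2 : (fun s : ℂ => exp (k * s)) =O[stripLeft Real.pi]
          fun s => Real.exp (k * s.re) := by
        refine Asymptotics.isBigO_of_le _ fun s => ?_
        rw [norm_exp, Real.norm_of_nonneg (Real.exp_pos _).le]; simp
      have h3 := (hc.trans (isBigO_exp_of_le hk)).mul h2
      refine h3.trans (Asymptotics.isBigO_of_le _ fun s => le_of_eq ?_)
      rw [← Real.exp_add]; simp
    obtain ⟨K, hK⟩ := h1.bound
    refine Asymptotics.IsBigO.of_bound K ?_
    rw [stripLeft, eventually_inf_principal, eventually_comap] at hK
    rw [eventually_comap]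
    filter_upwards [hK] with x hx s hs
    obtain ⟨n, hn⟩ := exp_eq_exp_iff_exists_int.1 (exp_log (exp_ne_zero s))
    have h4 : G (log (exp s)) = G s := by
      rw [hn]; exact hGp.int_mul n s
    have h5 : (log (exp s)).re = x := by rw [log_re, norm_exp, Real.log_exp, hs]
    have := hx _ h5 (abs_le.2 ⟨(neg_pi_lt_log_im _).le, log_im_le_pi _⟩)
    rwa [h4] at this
  set F : ℂ → ℂ := fun x => G (2 * Real.pi * I * x) with hF
  have hFp : Function.Periodic F ((1 : ℝ) : ℂ) := fun x => by
    simp only [hF, mul_add, ofReal_one, mul_one]; exact hGp _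
  have ht : Tendsto (fun x : ℂ => 2 * Real.pi * I * x) (comap im atTop) (comap re atBot) := by
    refine tendsto_comap_iff.2 ?_
    have : Tendsto (fun x : ℂ => (-(2 * Real.pi)) * x.im) (comap im atTop) atBot :=
      tendsto_comap.const_mul_atTop_of_neg (by simp [Real.pi_pos])
    convert! this using 1
    ext x; simp
  have hFd : ∀ᶠ x in comap im atTop, DifferentiableAt ℂ F x :=
    (ht.eventually hGd).mono fun x hx =>
      DifferentiableAt.comp (g := G) x hx (by fun_prop)
  have hFb : BoundedAtFilter (comap im atTop) F := by
    have := hGb.comp_tendsto ht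
    exact this
  refine ⟨Function.Periodic.cuspFunction 1 F, -k, ?_, fun s => ?_⟩
  · rw [analyticAt_iff_eventually_differentiableAt]
    have h1 := Function.Periodic.eventually_differentiableAt_cuspFunction_nhds_ne_zero
      one_pos hFp hFd
    have h2 := Function.Periodic.differentiableAt_cuspFunction_zero one_pos hFp hFd hFb
    filter_upwards [eventually_nhdsWithin_iff.1 h1] with q hq
    by_cases hq0 : q = 0
    · rwa [hq0]
    · exact hq hq0
  · have h1 := Function.Periodic.eq_cuspFunction one_ne_zero hFp (s / (2 * Real.pi * I))
    have h2 : Function.Periodic.qParam 1 (s / (2 * Real.pi * I)) = exp s := by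
      rw [Function.Periodic.qParam, ofReal_one, div_one, mul_div_cancel₀ _ two_pi_I_ne_zero]
    rw [← h2, h1, hF, hG]
    simp only [mul_div_cancel₀ _ two_pi_I_ne_zero]
    rw [mul_assoc, ← exp_add]; simp

/-- An entire function of moderate growth which is annihilated by a polynomial in the monodromy,
with non-zero roots, belongs to the Nilsson class. -/
theorem mem_nilssonSpan_of_roots (m : Multiset ℂ) (hm : ∀ μ ∈ m, μ ≠ 0) {w : ℂ → ℂ}
    (hd : Differentiable ℂ w) (hg : IsModerate w)
    (hw : Polynomial.aeval monodromyShift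
      ((m.map fun μ => Polynomial.X - Polynomial.C μ).prod) w = 0) :
    w ∈ nilssonSpan := by
  induction m using Multiset.induction_on generalizing w with
  | empty =>
    simp only [Multiset.map_zero, Multiset.prod_zero, map_one, Module.End.one_apply] at hw
    rw [hw]; exact Submodule.zero_mem _
  | cons μ m ih =>
    rw [Multiset.map_cons, Multiset.prod_cons, mul_comm, map_mul, Module.End.mul_apply] at hw
    have hμ : μ ≠ 0 := hm μ (Multiset.mem_cons_self _ _)
    set D : Module.End ℂ (ℂ → ℂ) := monodromyShift - μ • (1 : Module.End ℂ (ℂ → ℂ)) with hD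
    have hD' : Polynomial.aeval monodromyShift (Polynomial.X - Polynomial.C μ) = D := by
      simp [hD, Algebra.algebraMap_eq_smul_one]
    have hDa : ∀ v s, D v s = v (s + 2 * Real.pi * I) - μ * v s := fun v s => rfl
    rw [hD'] at hw
    have h1 : D w ∈ nilssonSpan := by
      refine ih (fun ν hν => hm ν (Multiset.mem_cons_of_mem hν)) ?_ ?_ hw
      · have : D w = fun s => w (s + 2 * Real.pi * I) - μ * w s := rfl
        rw [this]; fun_prop
      · have : D w = monodromyShift w + (-μ) • w := by simp [hD, sub_eq_add_neg]
        rw [this]; exact hg.shift.add (hg.smul _)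
    obtain ⟨w₀, hw₀, hw₀'⟩ := Submodule.mem_map.1 (nilssonSpan_le_map μ h1)
    -- the translation multiplies `u` by `μ`, so that `u(s) exp(-α s)` is periodic
    set u : ℂ → ℂ := w - w₀ with hu
    have hus : ∀ s, u (s + 2 * Real.pi * I) = μ * u s := fun s => by
      have : D u s = 0 := by rw [hu, map_sub, ← hw₀']; simp [hD]
      rw [hDa] at this; exact sub_eq_zero.1 this
    have hum : IsModerate u := by
      have := hg.add ((isModerate_of_mem hw₀).smul (-1))
      rwa [neg_one_smul, ← sub_eq_add_neg] at this
    set α : ℂ := log μ / (2 * Real.pi * I) with hα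
    have hαμ : exp (-α * (2 * Real.pi * I)) = μ⁻¹ := by
      rw [neg_mul, exp_neg, hα, div_mul_cancel₀ _ two_pi_I_ne_zero, exp_log hμ]
    obtain ⟨h, β, hh, hβ⟩ := exists_analytic_of_periodic (g := u * fun s => exp (-α * s))
      (fun s => by
        simp only [Pi.mul_apply, hus, mul_add, exp_add, hαμ]
        field_simp)
      (by
        filter_upwards [eventually_differentiableAt_of_mem hw₀] with s hs
        exact ((hd s).sub hs).mul (by fun_prop))
      (hum.mul (isModerate_exp _))
    have h2 : u = fun s => h (exp s) * exp ((α + β) * s) * s ^ 0 := by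
      ext s
      have h3 := hβ s
      simp only [Pi.mul_apply] at h3
      have h4 : u s = u s * exp (-α * s) * exp (α * s) := by
        rw [mul_assoc, ← exp_add]; simp
      rw [h4, h3, add_mul, exp_add]; ring
    have h3 : w = w₀ + u := by rw [hu]; abel
    rw [h3, h2]
    exact Submodule.add_mem _ hw₀ (generator_mem hh _ _)

/-- Entries of a matrix `U` of entire functions with `U(s + 2πi) = M U(s)`: the characteristic
polynomial of `M` annihilates them. -/
theorem mem_nilssonSpan_of_monodromy {n : ℕ} {U : ℂ → Matrix (Fin n) (Fin n) ℂ}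
    {M : Matrix (Fin n) (Fin n) ℂ} (hM : IsUnit M) (hU : ∀ s, U (s + 2 * Real.pi * I) = M * U s)
    (i j : Fin n) (hd : Differentiable ℂ fun s => U s i j) (hg : IsModerate fun s => U s i j) :
    (fun s => U s i j) ∈ nilssonSpan := by
  have hpow : ∀ (k : ℕ) s, (monodromyShift ^ k) (fun s => U s i j) s = (M ^ k * U s) i j := by
    intro k
    induction k with
    | zero => simp
    | succ k ih =>
      intro s
      rw [pow_succ', Module.End.mul_apply, monodromyShift_apply, ih, hU, ← mul_assoc, pow_succ]
  have hpoly : ∀ (p : ℂ[X]) s, (Polynomial.aeval monodromyShift p) (fun s => U s i j) s =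
      (Polynomial.aeval M p * U s) i j := by
    intro p s
    induction p using Polynomial.induction_on' with
    | add p q hp hq => simp [add_mul, hp, hq]
    | monomial k a =>
      simp [Polynomial.aeval_monomial, Algebra.algebraMap_eq_smul_one, hpow]
  have hsplit := (IsAlgClosed.splits M.charpoly).eq_prod_roots
  rw [(Matrix.charpoly_monic M).leadingCoeff, map_one, one_mul] at hsplit
  refine mem_nilssonSpan_of_roots M.charpoly.roots (fun μ hμ h0 => ?_) hd hg ?_
  · have h1 := Polynomial.isRoot_of_mem_roots hμ
    rw [h0, Polynomial.IsRoot, ← Polynomial.coeff_zero_eq_eval_zero] at h1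
    have h2 := Matrix.det_eq_sign_charpoly_coeff M
    rw [h1, mul_zero] at h2
    exact ((Matrix.isUnit_iff_isUnit_det M).1 hM).ne_zero h2
  · rw [← hsplit]
    ext s
    rw [hpoly, Matrix.aeval_self_charpoly]; simp

theorem isNilsson_of_mem {w g : ℂ → ℂ} (hw : w ∈ nilssonSpan)
    (hg : ∀ᶠ z in 𝓝[slitPlane] (0 : ℂ), g z = w (log z)) : IsNilsson g := by
  obtain ⟨n, c, G, rfl⟩ := Submodule.mem_span_set'.1 hw
  choose h α i hh hG using fun k => (G k).2
  refine ⟨Finset.univ.image α, Finset.univ.image i,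
    fun a j z => ∑ k, if α k = a ∧ i k = j then c k * h k z else 0, fun a _ j _ => ?_, ?_⟩
  · refine Finset.analyticAt_fun_sum _ fun k _ => ?_
    by_cases hk : α k = a ∧ i k = j
    · simp only [hk, and_self, if_true]
      exact analyticAt_const.mul (hh k)
    · simpa [hk] using analyticAt_const
  · filter_upwards [hg, self_mem_nhdsWithin] with z hz hzs
    have hz0 : z ≠ 0 := slitPlane_ne_zero hzs
    rw [hz]
    simp only [Finset.sum_apply, Pi.smul_apply, hG, smul_eq_mul, exp_log hz0, Finset.sum_mul,
      ite_mul, zero_mul]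
    have e : ∀ a ∈ Finset.univ.image α, (∑ j ∈ Finset.univ.image i, ∑ k,
        if α k = a ∧ i k = j then c k * h k z * z ^ a * log z ^ j else 0) =
        ∑ k, ∑ j ∈ Finset.univ.image i,
          if α k = a ∧ i k = j then c k * h k z * z ^ a * log z ^ j else 0 := fun a _ =>
      Finset.sum_comm
    rw [Finset.sum_congr rfl e, Finset.sum_comm]
    refine Finset.sum_congr rfl fun k _ => ?_
    rw [Finset.sum_eq_single (α k), Finset.sum_eq_single (i k)]
    · rw [if_pos ⟨rfl, rfl⟩, cpow_def_of_ne_zero hz0]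
      rw [mul_comm (log z) (α k)]; ring
    · exact fun j _ hj => if_neg fun h => hj h.2.symm
    · exact fun h => absurd (Finset.mem_image_of_mem i (Finset.mem_univ k)) h
    · exact fun a _ ha => Finset.sum_eq_zero fun j _ => if_neg fun h => ha h.1.symm
    · exact fun h => absurd (Finset.mem_image_of_mem α (Finset.mem_univ k)) h

end NilssonClass

/-! ### Fundamental matrix at a regular singularity -/

section FundamentalMatrix
attribute [local instance] Matrix.linftyOpNormedRing Matrix.linftyOpNormedAlgebra

theorem hasDerivAt_matrix {n : ℕ} {M : ℂ → Matrix (Fin n) (Fin n) ℂ}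
    {M' : Matrix (Fin n) (Fin n) ℂ} {z : ℂ}
    (h : ∀ i j, HasDerivAt (fun z => M z i j) (M' i j) z) : HasDerivAt M M' z := by
  have h1 : HasDerivAt (fun z => ∑ i, ∑ j, M z i j • Matrix.single i j (1 : ℂ))
      (∑ i, ∑ j, M' i j • Matrix.single i j (1 : ℂ)) z :=
    HasDerivAt.fun_sum fun i _ => HasDerivAt.fun_sum fun j _ => (h i j).smul_const _
  simpa only [Matrix.smul_single, smul_eq_mul, mul_one, ← Matrix.matrix_eq_sum_single] using h1

theorem hasDerivAt_entry {n : ℕ} {M : ℂ → Matrix (Fin n) (Fin n) ℂ}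
    {M' : Matrix (Fin n) (Fin n) ℂ} {z : ℂ} (h : HasDerivAt M M' z) (i j : Fin n) :
    HasDerivAt (fun z => M z i j) (M' i j) z :=
  (LinearMap.toContinuousLinearMap (Matrix.entryLinearMap ℂ ℂ i j)).hasFDerivAt.comp_hasDerivAt z h

theorem exists_norm_entry_le {n : ℕ} (i j : Fin n) :
    ∃ K : ℝ, ∀ M : Matrix (Fin n) (Fin n) ℂ, ‖M i j‖ ≤ K * ‖M‖ :=
  ⟨_, fun M => (LinearMap.toContinuousLinearMap
    (Matrix.entryLinearMap ℂ ℂ i j : Matrix (Fin n) (Fin n) ℂ →ₗ[ℂ] ℂ)).le_opNorm M⟩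

/-- Evaluation of a matrix of polynomials. -/
def evalMatrix {n : ℕ} (z : ℂ) : Matrix (Fin n) (Fin n) ℂ[X] →+* Matrix (Fin n) (Fin n) ℂ :=
  (Polynomial.evalRingHom z).mapMatrix

theorem evalMatrix_apply {n : ℕ} (z : ℂ) (M : Matrix (Fin n) (Fin n) ℂ[X]) (i j : Fin n) :
    evalMatrix z M i j = (M i j).eval z := rfl

theorem evalMatrix_smul {n : ℕ} (z : ℂ) (q : ℂ[X]) (M : Matrix (Fin n) (Fin n) ℂ[X]) :
    evalMatrix z (q • M) = q.eval z • evalMatrix z M := by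
  ext i j; simp [evalMatrix_apply]

theorem hasDerivAt_evalMatrix {n : ℕ} (M : Matrix (Fin n) (Fin n) ℂ[X]) (z : ℂ) :
    HasDerivAt (fun z => evalMatrix z M) (evalMatrix z (M.map Polynomial.derivative)) z :=
  hasDerivAt_matrix fun i j => (M i j).hasDerivAt z

/-- A system with a regular singularity at `0`: existence of a fundamental matrix of solutions (as
rows) of the adjoint system, on the universal covering `z = exp s` of `ℂ \ {0}`; its entries belong
to the Nilsson class and have moderate growth. -/
theorem IsRegularSingularAtZero.exists_fundamental_matrix {n : ℕ}
    {B : Matrix (Fin n) (Fin n) ℚ[T;T⁻¹]}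
    (hB : IsRegularSingularAtZero (B.map laurentToSeries)) :
    ∃ U : ℂ → Matrix (Fin n) (Fin n) ℂ, U 0 = 1 ∧
      (∀ s i j, HasDerivAt (fun s => U s i j)
        (-∑ l, U s i l * (Complex.exp s * evalLaurent (B l j) (Complex.exp s))) s) ∧
      (∀ i j, (fun s => U s i j) ∈ nilssonSpan) ∧
      ∃ c : ℝ, ∀ i j, (fun s => U s i j) =O[stripLeft Real.pi] fun s => Real.exp (-(c * s.re)) := by
  obtain ⟨d, p, a, C, T, L, H, Q, Q', hC, h₁, h₂⟩ := hB.exists_polynomial_gauge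
  have : CompleteSpace (Matrix (Fin n) (Fin n) ℂ) := FiniteDimensional.complete ℂ _
  set A : ℂ → Matrix (Fin n) (Fin n) ℂ := fun s =>
    Matrix.of fun i j => Complex.exp s * evalLaurent (B i j) (Complex.exp s) with hAdef
  have hA : ∀ s, Complex.exp s ^ d • A s = evalMatrix (Complex.exp s) C := fun s => by
    ext i j
    rw [evalMatrix_apply, ← hC _ (Complex.exp_ne_zero s)]
    simp [hAdef, pow_succ, mul_assoc]
  have hA' : Differentiable ℂ A := fun s => by
    have h : A = fun s => Complex.exp (-(d * s)) • evalMatrix (Complex.exp s) C := by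
      ext1 s
      rw [← hA, smul_smul, ← Complex.exp_nat_mul, ← Complex.exp_add]; simp
    rw [h]
    have h1 : DifferentiableAt ℂ (fun s => evalMatrix (Complex.exp s) C) s :=
      (hasDerivAt_evalMatrix C _).differentiableAt.comp s Complex.differentiableAt_exp
    exact DifferentiableAt.fun_smul (by fun_prop) h1
  obtain ⟨U, hU0, hU⟩ := exists_entire_solution hA'.neg
  simp only [Pi.neg_apply, mul_neg] at hU
  obtain ⟨M, hM, hUM⟩ := exists_monodromy (τ := 2 * Real.pi * Complex.I) hA'
    (fun s => by simp only [hAdef, exp_add_two_pi]) hU hU0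
  have hcont : ∀ q : Matrix (Fin n) (Fin n) ℂ[X],
      ∀ z, ContinuousAt (fun z => evalMatrix z q) z := fun q z =>
    (hasDerivAt_evalMatrix q z).continuousAt
  obtain ⟨c, -, x₀, hgrow⟩ := exists_moderate_growth (C := fun z => evalMatrix z C)
    (L := fun z => evalMatrix z L) (H := fun z => evalMatrix z H) (Q := fun z => evalMatrix z Q)
    (Q' := fun z => evalMatrix z Q') (p := p) (a := a) hU hA (hasDerivAt_evalMatrix T)
    (continuous_iff_continuousAt.2 (hcont L)) (continuous_iff_continuousAt.2 (hcont H))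
    (continuous_iff_continuousAt.2 (hcont Q)) (continuous_iff_continuousAt.2 (hcont Q'))
    (fun z => by
      simpa [evalMatrix_smul] using congrArg (evalMatrix z) h₁)
    (fun z => by
      simpa [evalMatrix_smul] using congrArg (evalMatrix z) h₂)
  have hO : ∀ (b : ℝ) i j, (fun s => U s i j) =O[stripLeft b] fun s => Real.exp (-(c * s.re)) := by
    intro b i j
    obtain ⟨K, hK⟩ := hgrow b
    obtain ⟨K', hK'⟩ := exists_norm_entry_le i j
    refine Asymptotics.IsBigO.trans (g := U) (Asymptotics.IsBigO.of_bound K'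
      (Filter.Eventually.of_forall fun s => hK' (U s))) (Asymptotics.IsBigO.of_bound K ?_)
    filter_upwards [eventually_re_le b x₀, eventually_im_le b] with s hs hs'
    rw [Real.norm_of_nonneg (Real.exp_pos _).le]
    exact hK s hs hs'
  have hder : ∀ s i j, HasDerivAt (fun s => U s i j)
        (-∑ l, U s i l * (Complex.exp s * evalLaurent (B l j) (Complex.exp s))) s :=
    fun s i j => hasDerivAt_entry (hU s) i j
  exact ⟨U, hU0, hder, fun i j => mem_nilssonSpan_of_monodromy hM hUM i j
    (fun s => (hder s i j).differentiableAt) fun b => ⟨c, hO b i j⟩, c, hO Real.pi⟩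

end FundamentalMatrix

/-! ### Coefficient calculus and the graded system -/

section CoefficientCalculus
open MvPolynomial
variable {m : ℕ}

/-- Coefficientwise derivative of a family of polynomials. -/
def HasCoeffDerivAt (p : ℂ → MvPolynomial (Fin m) ℂ) (p' : MvPolynomial (Fin m) ℂ) (z : ℂ) : Prop :=
  ∀ κ, HasDerivAt (fun z => coeff κ (p z)) (coeff κ p') z

theorem hasCoeffDerivAt_const (p : MvPolynomial (Fin m) ℂ) (z : ℂ) :
    HasCoeffDerivAt (fun _ => p) 0 z := fun κ => by
  simpa using hasDerivAt_const z (coeff κ p)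

theorem HasCoeffDerivAt.mul {p q : ℂ → MvPolynomial (Fin m) ℂ} {p' q' : MvPolynomial (Fin m) ℂ}
    {z : ℂ} (hp : HasCoeffDerivAt p p' z) (hq : HasCoeffDerivAt q q' z) :
    HasCoeffDerivAt (fun z => p z * q z) (p' * q z + p z * q') z := fun κ => by
  simp only [coeff_mul, coeff_add, ← Finset.sum_add_distrib]
  exact HasDerivAt.fun_sum fun x _ => (hp x.1).mul (hq x.2)

theorem HasCoeffDerivAt.sum {ι : Type*} {t : Finset ι} {p : ι → ℂ → MvPolynomial (Fin m) ℂ}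
    {p' : ι → MvPolynomial (Fin m) ℂ} {z : ℂ} (h : ∀ i ∈ t, HasCoeffDerivAt (p i) (p' i) z) :
    HasCoeffDerivAt (fun z => ∑ i ∈ t, p i z) (∑ i ∈ t, p' i) z := fun κ => by
  simp only [coeff_sum]
  exact HasDerivAt.fun_sum fun i hi => h i hi κ

theorem hasCoeffDerivAt_C {g : ℂ → ℂ} {g' z : ℂ} (h : HasDerivAt g g' z) :
    HasCoeffDerivAt (m := m) (fun z => C (g z)) (C g') z := fun κ => by
  simp only [coeff_C]
  by_cases hκ : 0 = κ
  · simpa only [hκ, if_true] using h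
  · simpa only [hκ, if_false] using hasDerivAt_const z (0 : ℂ)

theorem HasCoeffDerivAt.pow {p : ℂ → MvPolynomial (Fin m) ℂ} {p' : MvPolynomial (Fin m) ℂ} {z : ℂ}
    (hp : HasCoeffDerivAt p p' z) (n : ℕ) :
    HasCoeffDerivAt (fun z => p z ^ n) (n * p z ^ (n - 1) * p') z := by
  induction n with
  | zero => simpa using hasCoeffDerivAt_const 1 z
  | succ n ih =>
    have := ih.mul hp
    simp only [pow_succ]
    convert this using 1
    rcases n with _ | n
    · simp
    · simp only [Nat.add_sub_cancel, pow_succ]; push_cast; ring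

theorem HasCoeffDerivAt.prod {ι : Type*} [DecidableEq ι] {t : Finset ι}
    {p : ι → ℂ → MvPolynomial (Fin m) ℂ}
    {p' : ι → MvPolynomial (Fin m) ℂ} {z : ℂ} (h : ∀ i ∈ t, HasCoeffDerivAt (p i) (p' i) z) :
    HasCoeffDerivAt (fun z => ∏ i ∈ t, p i z) (∑ i ∈ t, (∏ j ∈ t.erase i, p j z) * p' i) z := by
  induction t using Finset.induction_on with
  | empty => simpa using hasCoeffDerivAt_const 1 z
  | insert a t ha ih =>
    have := (h a (Finset.mem_insert_self _ _)).mul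
      (ih fun i hi => h i (Finset.mem_insert_of_mem hi))
    simp only [Finset.prod_insert ha]
    convert this using 1
    rw [Finset.sum_insert ha, Finset.erase_insert ha, Finset.mul_sum, mul_comm (p' a)]
    congr 1
    refine Finset.sum_congr rfl fun i hi => ?_
    have hia : a ≠ i := fun h => ha (h ▸ hi)
    rw [Finset.erase_insert_of_ne hia, Finset.prod_insert (by simp [ha]), mul_assoc]

/-- The monomial `u ^ κ = ∏ u_l ^ κ_l`. -/
def mono {R : Type*} [CommMonoid R] (u : Fin m → R) (κ : Fin m → ℕ) : R := ∏ l, u l ^ κ l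

theorem mono_add_e {R : Type*} [CommMonoid R] (u : Fin m → R) (κ : Fin m → ℕ) (j : Fin m) :
    mono u (κ + e j) = mono u κ * u j := by
  simp only [mono, Pi.add_apply, pow_add, Finset.prod_mul_distrib]
  congr 1
  rw [Finset.prod_eq_single j]
  · simp [e]
  · intro l _ hl; simp [e, hl]
  · simp

theorem sum_add_e (κ : Fin m → ℕ) (j : Fin m) : ∑ l, (κ + e j) l = ∑ l, κ l + 1 := by
  simp [e, Finset.sum_add_distrib]

theorem sub_add_e {κ : Fin m → ℕ} {j : Fin m} (h : κ j ≠ 0) : κ - e j + e j = κ := by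
  funext l
  by_cases hl : l = j
  · subst hl; simp [e]; omega
  · simp [e, hl]

theorem hasCoeffDerivAt_mono {u : Fin m → ℂ → MvPolynomial (Fin m) ℂ}
    {u' : Fin m → MvPolynomial (Fin m) ℂ} {z : ℂ} (h : ∀ i, HasCoeffDerivAt (u i) (u' i) z)
    (κ : Fin m → ℕ) :
    HasCoeffDerivAt (fun z => mono (fun l => u l z) κ)
      (∑ j, (κ j : MvPolynomial (Fin m) ℂ) * (mono (fun l => u l z) (κ - e j) * u' j)) z := by
  have := HasCoeffDerivAt.prod (t := Finset.univ) fun i _ => (h i).pow (κ i)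
  unfold mono
  convert this using 1
  refine Finset.sum_congr rfl fun j _ => ?_
  rw [← Finset.mul_prod_erase Finset.univ _ (Finset.mem_univ j)]
  have h1 : ∏ l ∈ Finset.univ.erase j, u l z ^ (κ - e j) l = ∏ l ∈ Finset.univ.erase j, u l z ^ κ l :=
    Finset.prod_congr rfl fun l hl => by simp [e, (Finset.mem_erase.1 hl).1]
  rw [h1]
  simp only [Pi.sub_apply, e, Pi.single_eq_same]
  ring

/-- All coefficients are `O(exp(- c Re s))` at the left end of the strip `|Im s| ≤ π`. -/
def CoeffIsBigO (p : ℂ → MvPolynomial (Fin m) ℂ) (c : ℝ) : Prop :=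
  ∀ κ, (fun s => coeff κ (p s)) =O[stripLeft Real.pi] fun s => Real.exp (-(c * s.re))

theorem CoeffIsBigO.mul {p q : ℂ → MvPolynomial (Fin m) ℂ} {c c' : ℝ} (hp : CoeffIsBigO p c)
    (hq : CoeffIsBigO q c') : CoeffIsBigO (fun s => p s * q s) (c + c') := fun κ => by
  simp only [coeff_mul]
  refine Asymptotics.IsBigO.fun_sum fun x _ => ?_
  refine ((hp x.1).mul (hq x.2)).trans (Asymptotics.isBigO_of_le _ fun s => le_of_eq ?_)
  rw [← Real.exp_add]; congr 2; ring

theorem coeffIsBigO_one : CoeffIsBigO (m := m) (fun _ => 1) 0 := fun κ => by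
  simpa using Asymptotics.isBigO_const_const (coeff κ (1 : MvPolynomial (Fin m) ℂ))
    (one_ne_zero (α := ℝ)) (stripLeft Real.pi)

theorem CoeffIsBigO.pow {p : ℂ → MvPolynomial (Fin m) ℂ} {c : ℝ} (hp : CoeffIsBigO p c) (n : ℕ) :
    CoeffIsBigO (fun s => p s ^ n) (n * c) := by
  induction n with
  | zero => simpa using coeffIsBigO_one
  | succ n ih =>
    have := ih.mul hp
    simp only [pow_succ]
    convert this using 1
    push_cast; ring

theorem CoeffIsBigO.mono {u : Fin m → ℂ → MvPolynomial (Fin m) ℂ} {c : ℝ}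
    (h : ∀ i, CoeffIsBigO (u i) c) (κ : Fin m → ℕ) :
    CoeffIsBigO (fun s => mono (fun l => u l s) κ) (((∑ l, κ l : ℕ) : ℝ) * c) := by
  have : ∀ t : Finset (Fin m), CoeffIsBigO (fun s => ∏ l ∈ t, u l s ^ κ l)
      (((∑ l ∈ t, κ l : ℕ) : ℝ) * c) := by
    intro t
    induction t using Finset.induction_on with
    | empty => simpa using coeffIsBigO_one
    | insert a t ha ih =>
      simp only [Finset.prod_insert ha, Finset.sum_insert ha]
      convert ((h a).pow (κ a)).mul ih using 1
      push_cast; ring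
  exact this Finset.univ

/-- All coefficients, as functions of `s = log z`, belong to the Nilsson class. -/
def CoeffMem (p : ℂ → MvPolynomial (Fin m) ℂ) : Prop :=
  ∀ κ, (fun s => coeff κ (p s)) ∈ nilssonSpan

theorem CoeffMem.mul {p q : ℂ → MvPolynomial (Fin m) ℂ} (hp : CoeffMem p) (hq : CoeffMem q) :
    CoeffMem fun s => p s * q s := fun κ => by
  have : (fun s => coeff κ (p s * q s)) = ∑ x ∈ Finset.HasAntidiagonal.antidiagonal κ,
      (fun s => coeff x.1 (p s)) * fun s => coeff x.2 (q s) := by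
    ext s; simp [coeff_mul]
  rw [this]
  exact Submodule.sum_mem _ fun x _ => mul_mem_nilssonSpan (hp x.1) (hq x.2)

theorem const_mem_nilssonSpan (a : ℂ) : (fun _ => a) ∈ nilssonSpan :=
  analytic_mem (h := fun _ => a) analyticAt_const

theorem coeffMem_mono {u : Fin m → ℂ → MvPolynomial (Fin m) ℂ} (h : ∀ i, CoeffMem (u i))
    (κ : Fin m → ℕ) : CoeffMem fun s => mono (fun l => u l s) κ := by
  have hpow : ∀ i n, CoeffMem fun s => u i s ^ n := by
    intro i n
    induction n with
    | zero => intro κ; simpa using const_mem_nilssonSpan _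
    | succ n ih => simp only [pow_succ]; exact ih.mul (h i)
  have : ∀ t : Finset (Fin m), CoeffMem fun s => ∏ l ∈ t, u l s ^ κ l := by
    intro t
    induction t using Finset.induction_on with
    | empty => intro κ; simpa using const_mem_nilssonSpan _
    | insert a t ha ih =>
      simp only [Finset.prod_insert ha]
      exact (hpow a (κ a)).mul ih
  exact this Finset.univ

end CoefficientCalculus

section System
variable {m N : ℕ} {R : Type*} [CommRing R] [Algebra ℂ R]

/-- The generating solution `y_κ` of the graded system: `u ^ κ` if `|κ| = N`, and `u ^ κ F` if
`|κ| = N - 1`. -/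
def gradedSolution (N : ℕ) (u : Fin m → R) (F : R) (κ : Fin m → ℕ) : R :=
  mono u κ * if ∑ j, κ j = N then 1 else F

/-- `evalLaurent` at a fixed point, as an additive map. -/
def evalLaurentHom (z : ℂ) : ℚ[T;T⁻¹] →+ ℂ :=
  AddMonoidHom.mk' (fun s => evalLaurent s z) fun s t => evalLaurent_add s t z

theorem evalLaurent_systemMatrix (S : Fin m → Fin (m + 1) → ℚ[T;T⁻¹]) (lam κ : Omega m N) (z : ℂ) :
    evalLaurent (systemMatrix S N lam κ) z =
      (∑ j, ∑ l, if κ.1 + e j = lam.1 + e l then -((lam.1 j : ℂ) * evalLaurent (S l j.succ) z)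
        else 0) + ∑ j, if κ.1 = lam.1 + e j then evalLaurent (S j 0) z else 0 := by
  have h : ∀ s, evalLaurent s z = evalLaurentHom z s := fun _ => rfl
  simp only [h, systemMatrix, Matrix.of_apply, map_add, map_sum]
  congr 1
  · refine Finset.sum_congr rfl fun j _ => Finset.sum_congr rfl fun l _ => ?_
    split_ifs
    · rw [map_neg, ← nsmul_eq_mul, map_nsmul, nsmul_eq_mul]
    · exact map_zero _
  · refine Finset.sum_congr rfl fun j _ => ?_
    split_ifs
    · rfl
    · exact map_zero _

/-- The right-hand side of the graded system at the generating solution. -/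
theorem sum_systemMatrix_smul (S : Fin m → Fin (m + 1) → ℚ[T;T⁻¹]) (z : ℂ) (u : Fin m → R) (F : R)
    (lam : Omega m N) :
    ∑ κ : Omega m N, evalLaurent (systemMatrix S N lam κ) z • gradedSolution N u F κ.1 =
      (∑ j, (lam.1 j : R) * (mono u (lam.1 - e j) *
        -∑ l, evalLaurent (S l j.succ) z • u l)) * (if ∑ j, lam.1 j = N then 1 else F) +
      mono u lam.1 * if ∑ j, lam.1 j = N then 0 else ∑ j, evalLaurent (S j 0) z • u j := by
  simp only [evalLaurent_systemMatrix, add_smul, Finset.sum_add_distrib, Finset.sum_smul]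
  congr 1
  · rw [Finset.sum_comm, Finset.sum_mul]
    refine Finset.sum_congr rfl fun j _ => ?_
    rw [Finset.sum_comm, ← Finset.sum_neg_distrib, Finset.mul_sum, Finset.mul_sum, Finset.sum_mul]
    refine Finset.sum_congr rfl fun l _ => ?_
    by_cases hj : lam.1 j = 0
    · simp [hj]
    · have hsum : ∑ i, (lam.1 - e j + e l) i = ∑ i, lam.1 i := by
        rw [sum_add_e, ← sum_add_e (lam.1 - e j) j, sub_add_e hj]
      have hmem : lam.1 - e j + e l ∈ Omega m N := by
        rw [mem_Omega, hsum]; exact mem_Omega.1 lam.2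
      rw [Finset.sum_eq_single ⟨_, hmem⟩]
      · have h1 : lam.1 - e j + e l + e j = lam.1 + e l := by
          rw [add_right_comm, sub_add_e hj]
        rw [if_pos h1, gradedSolution, hsum, mono_add_e, Algebra.smul_def, Algebra.smul_def]
        simp only [map_neg, map_mul, map_natCast]
        ring
      · intro κ _ hκ
        rw [if_neg, zero_smul]
        intro h
        refine hκ (Subtype.ext ?_)
        have h1 : κ.1 + e j = (lam.1 - e j + e l) + e j := by
          rw [h, add_right_comm, sub_add_e hj]
        exact add_right_cancel h1
      · intro h; exact absurd (Finset.mem_univ _) h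
  · rw [Finset.sum_comm]
    have hlam := mem_Omega.1 lam.2
    by_cases h : ∑ j, lam.1 j = N
    · rw [if_pos h, mul_zero]
      refine Finset.sum_eq_zero fun j _ => Finset.sum_eq_zero fun κ _ => ?_
      rw [if_neg, zero_smul]
      intro hκ
      have h1 := (mem_Omega.1 κ.2).2
      rw [hκ, sum_add_e, h] at h1
      omega
    · rw [if_neg h, Finset.mul_sum]
      refine Finset.sum_congr rfl fun j _ => ?_
      have hsum : ∑ i, (lam.1 + e j) i = N := by rw [sum_add_e]; omega
      have hmem : lam.1 + e j ∈ Omega m N := mem_Omega.2 (by rw [hsum]; omega)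
      rw [Finset.sum_eq_single ⟨_, hmem⟩]
      · rw [if_pos rfl, gradedSolution, if_pos hsum, mono_add_e, mul_one, mul_smul_comm]
      · intro κ _ hκ
        rw [if_neg, zero_smul]
        exact fun h => hκ (Subtype.ext h)
      · intro h; exact absurd (Finset.mem_univ _) h

/-- The linear forms `P_κ + ∑ P_{κ - e_j} f_j` appear as coefficients of the remainder of the
generating solution. -/
theorem sum_smul_gradedSolution (P : (Fin m → ℕ) → ℂ[X]) (z : ℂ) (φ : Fin m → ℂ)
    (u : Fin m → R) :
    ∑ κ : Omega m N, (P κ).eval z • gradedSolution N u (∑ j, φ j • u j) κ.1 =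
      ∑ κ ∈ Theta m N, ((P κ).eval z + ∑ j, (shift P κ j).eval z * φ j) • mono u κ := by
  have h0 : ∑ κ : Omega m N, (P κ).eval z • gradedSolution N u (∑ j, φ j • u j) κ.1 =
      ∑ κ ∈ Omega m N, (P κ).eval z • gradedSolution N u (∑ j, φ j • u j) κ :=
    Finset.sum_coe_sort (Omega m N) fun κ => (P κ).eval z • gradedSolution N u (∑ j, φ j • u j) κ
  rw [h0, ← Finset.sum_filter_add_sum_filter_not (Omega m N) (fun κ => ∑ j, κ j = N)]
  simp only [add_smul, Finset.sum_add_distrib]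
  congr 1
  · refine Finset.sum_congr ?_ fun κ hκ => ?_
    · ext κ; rw [Finset.mem_filter, mem_Omega, mem_Theta]; omega
    · rw [gradedSolution, if_pos (mem_Theta.1 hκ), mul_one]
  · have h1 : ∀ κ ∈ (Omega m N).filter (fun κ => ¬ ∑ j, κ j = N),
        (P κ).eval z • gradedSolution N u (∑ j, φ j • u j) κ =
          ∑ j, ((P κ).eval z * φ j) • mono u (κ + e j) := by
      intro κ hκ
      rw [gradedSolution, if_neg (Finset.mem_filter.1 hκ).2, Finset.mul_sum, Finset.smul_sum]
      refine Finset.sum_congr rfl fun j _ => ?_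
      rw [mono_add_e, mul_smul_comm, smul_smul]
    rw [Finset.sum_congr rfl h1, Finset.sum_comm]
    simp only [Finset.sum_smul]
    rw [Finset.sum_comm (s := Theta m N)]
    refine Finset.sum_congr rfl fun j _ => ?_
    have h2 : ∑ κ ∈ Theta m N, ((shift P κ j).eval z * φ j) • mono u κ =
        ∑ κ ∈ (Theta m N).filter (fun κ => κ j ≠ 0), ((P (κ - e j)).eval z * φ j) • mono u κ := by
      rw [Finset.sum_filter]
      refine Finset.sum_congr rfl fun κ _ => ?_
      by_cases hκ : κ j = 0 <;> simp [shift, hκ]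
    rw [h2]
    have h3 : ∀ κ : Fin m → ℕ, κ + e j - e j = κ := fun κ => by funext l; simp
    refine Finset.sum_nbij' (fun κ => κ + e j) (fun κ => κ - e j) ?_ ?_ ?_ ?_ ?_
    · intro κ hκ
      rw [Finset.mem_filter, mem_Omega] at hκ
      rw [Finset.mem_filter, mem_Theta, sum_add_e]
      refine ⟨by omega, by simp [e]⟩
    · intro κ hκ
      rw [Finset.mem_filter, mem_Theta] at hκ
      have h4 := sum_add_e (κ - e j) j
      rw [sub_add_e hκ.2] at h4
      rw [Finset.mem_filter, mem_Omega]
      omega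
    · exact fun κ _ => h3 κ
    · exact fun κ hκ => sub_add_e (Finset.mem_filter.1 hκ).2
    · intro κ _
      rw [h3]

end System

/-! ### Power series and uniqueness of the system -/

section Series

/-- The power series `φ` converges normally on the open unit disc, with sum `g`. -/
def HasSeries (φ : PowerSeries ℂ) (g : ℂ → ℂ) : Prop :=
  ∀ z : ℂ, ‖z‖ < 1 → Summable (fun n => ‖PowerSeries.coeff n φ * z ^ n‖) ∧
    HasSum (fun n => PowerSeries.coeff n φ * z ^ n) (g z)

theorem HasSeries.add {φ ψ : PowerSeries ℂ} {g h : ℂ → ℂ} (hg : HasSeries φ g)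
    (hh : HasSeries ψ h) : HasSeries (φ + ψ) fun z => g z + h z := fun z hz => by
  obtain ⟨h1, h2⟩ := hg z hz
  obtain ⟨h3, h4⟩ := hh z hz
  simp only [map_add, add_mul]
  exact ⟨Summable.of_nonneg_of_le (fun _ => norm_nonneg _) (fun _ => norm_add_le _ _) (h1.add h3),
    h2.add h4⟩

theorem HasSeries.mul {φ ψ : PowerSeries ℂ} {g h : ℂ → ℂ} (hg : HasSeries φ g)
    (hh : HasSeries ψ h) : HasSeries (φ * ψ) fun z => g z * h z := fun z hz => by
  obtain ⟨h1, h2⟩ := hg z hz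
  obtain ⟨h3, h4⟩ := hh z hz
  have e : (fun n => PowerSeries.coeff n (φ * ψ) * z ^ n) = fun n =>
      ∑ x ∈ Finset.HasAntidiagonal.antidiagonal n,
        (PowerSeries.coeff x.1 φ * z ^ x.1) * (PowerSeries.coeff x.2 ψ * z ^ x.2) := by
    ext n
    rw [PowerSeries.coeff_mul, Finset.sum_mul]
    refine Finset.sum_congr rfl fun x hx => ?_
    rw [← Finset.HasAntidiagonal.mem_antidiagonal.1 hx, pow_add]; ring
  have h5 := summable_norm_sum_mul_antidiagonal_of_summable_norm h1 h3
  have h6 := tsum_mul_tsum_eq_tsum_sum_antidiagonal_of_summable_norm h1 h3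
  rw [h2.tsum_eq, h4.tsum_eq] at h6
  have e' : (fun n => ‖PowerSeries.coeff n (φ * ψ) * z ^ n‖) = fun n =>
      ‖∑ x ∈ Finset.HasAntidiagonal.antidiagonal n,
        (PowerSeries.coeff x.1 φ * z ^ x.1) * (PowerSeries.coeff x.2 ψ * z ^ x.2)‖ := by
    ext n; rw [← congrFun e n]
  rw [e, e']
  beta_reduce
  rw [h6]
  exact ⟨h5, h5.of_norm.hasSum⟩

theorem hasSeries_zero : HasSeries 0 fun _ => 0 := fun z _ => by
  simp

theorem HasSeries.sum {ι : Type*} (t : Finset ι) {φ : ι → PowerSeries ℂ} {g : ι → ℂ → ℂ}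
    (h : ∀ i ∈ t, HasSeries (φ i) (g i)) : HasSeries (∑ i ∈ t, φ i) fun z => ∑ i ∈ t, g i z := by
  classical
  induction t using Finset.induction_on with
  | empty => simpa using hasSeries_zero
  | insert a t ha ih =>
    simp only [Finset.sum_insert ha]
    exact (h a (Finset.mem_insert_self _ _)).add (ih fun i hi => h i (Finset.mem_insert_of_mem hi))

theorem hasSeries_polynomial (p : ℂ[X]) : HasSeries (p : PowerSeries ℂ) fun z => p.eval z :=
    fun z _ => by
  have h0 : ∀ n ∉ Finset.range (p.natDegree + 1),
      PowerSeries.coeff n (p : PowerSeries ℂ) * z ^ n = 0 := fun n hn => by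
    rw [Polynomial.coeff_coe, Polynomial.coeff_eq_zero_of_natDegree_lt (by simpa using hn), zero_mul]
  have h1 := hasSum_sum_of_ne_finset_zero (L := SummationFilter.unconditional ℕ) h0
  refine ⟨summable_of_ne_finset_zero (s := Finset.range (p.natDegree + 1)) fun n hn => by
    rw [h0 n hn, norm_zero], ?_⟩
  simp only [Polynomial.coeff_coe] at h1 ⊢
  rwa [← Polynomial.eval_eq_sum_range] at h1

theorem HasSeries.hasFPowerSeriesAt {φ : PowerSeries ℂ} {g : ℂ → ℂ} (h : HasSeries φ g) :
    HasFPowerSeriesAt g (FormalMultilinearSeries.ofScalars ℂ fun n => PowerSeries.coeff n φ) 0 := by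
  refine ⟨1, ⟨ENNReal.le_of_forall_nnreal_lt fun r hr => ?_, one_pos, fun {y} hy => ?_⟩⟩
  · refine FormalMultilinearSeries.le_radius_of_summable_norm _ ?_
    have hr' : ‖((r : ℝ) : ℂ)‖ < 1 := by simpa using hr
    refine Summable.of_nonneg_of_le (fun n => by positivity) (fun n => ?_) (h _ hr').1
    rw [FormalMultilinearSeries.ofScalars_norm, norm_mul, norm_pow]
    simp
  · have hy' : ‖y‖ < 1 := by
      rw [Metric.mem_eball, edist_zero_right] at hy
      simpa [enorm_eq_nnnorm, ← NNReal.coe_lt_coe] using hy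
    rw [zero_add]
    simpa [FormalMultilinearSeries.ofScalars_apply_eq, mul_comm] using (h y hy').2

theorem HasSeries.analyticAt {φ : PowerSeries ℂ} {g : ℂ → ℂ} (h : HasSeries φ g) :
    AnalyticAt ℂ g 0 := h.hasFPowerSeriesAt.analyticAt

theorem HasSeries.eq_zero {φ : PowerSeries ℂ} (h : HasSeries φ fun _ => 0) : φ = 0 := by
  have h1 := h.hasFPowerSeriesAt.eq_zero
  ext n
  have h2 := congrArg (fun p => p.coeff n) h1
  rw [FormalMultilinearSeries.coeff_ofScalars] at h2
  rw [h2]; rfl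

theorem HasSeries.isBigO {φ : PowerSeries ℂ} {g : ℂ → ℂ} (h : HasSeries φ g) {K : ℕ}
    (hK : (K : ℕ∞) ≤ φ.order) : g =O[𝓝 0] fun z => ‖z‖ ^ K := by
  have hhalf : ‖(1 / 2 : ℂ)‖ < 1 := by norm_num
  have hs := (h _ hhalf).1
  refine Asymptotics.IsBigO.of_bound
    (2 ^ K * ∑' n, ‖PowerSeries.coeff n φ * (1 / 2 : ℂ) ^ n‖) ?_
  filter_upwards [Metric.ball_mem_nhds (0 : ℂ) (by norm_num : (0 : ℝ) < 1 / 2)] with z hz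
  have hz' : ‖z‖ ≤ 1 / 2 := by simpa using (Metric.mem_ball.1 hz).le
  have hz1 : ‖z‖ < 1 := by linarith
  have hle : ∀ n, ‖PowerSeries.coeff n φ * z ^ n‖ ≤
      (2 ^ K * ‖PowerSeries.coeff n φ * (1 / 2 : ℂ) ^ n‖) * ‖z‖ ^ K := by
    intro n
    rcases Nat.lt_or_ge n K with hn | hn
    · have : PowerSeries.coeff n φ = 0 :=
        PowerSeries.coeff_of_lt_order n (lt_of_lt_of_le (by exact_mod_cast hn) hK)
      simp [this]
    · obtain ⟨k, rfl⟩ := Nat.exists_eq_add_of_le hn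
      rw [norm_mul, norm_mul, norm_pow, norm_pow]
      have e1 : ‖(1 / 2 : ℂ)‖ = 1 / 2 := by norm_num
      rw [e1, pow_add, pow_add]
      have e2 : (2 : ℝ) ^ K * (‖PowerSeries.coeff (K + k) φ‖ * ((1 / 2) ^ K * (1 / 2) ^ k)) *
          ‖z‖ ^ K = ‖PowerSeries.coeff (K + k) φ‖ * (‖z‖ ^ K * (1 / 2) ^ k) := by
        rw [one_div, inv_pow, inv_pow]; field_simp
      rw [e2]
      gcongr
  have hs' := (hs.mul_left (2 ^ K)).mul_right (‖z‖ ^ K)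
  rw [← (h z hz1).2.tsum_eq, Real.norm_of_nonneg (by positivity), ← tsum_mul_left, ← tsum_mul_right]
  exact tsum_of_norm_bounded hs'.hasSum hle

/-- The coefficients of an `E`-function are bounded: the arithmetic growth condition with `ε = 1`
reads `|aₙ| ≤ n!`, and the coefficient of `zⁿ` is `aₙ / n!`. -/
theorem IsEFunction.hasSeries {F : PowerSeries ℚ}
    (hF : IsEFunction (F.map (algebraMap ℚ (AlgebraicClosure ℚ)))) :
    HasSeries (toC F) (evalSeries F) := by
  obtain ⟨-, hb, -⟩ := hF
  obtain ⟨n₀, hn₀⟩ := hb 1 one_pos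
  have : Algebra.IsAlgebraic ℚ (AlgebraicClosure ℚ) := by
    convert! AlgebraicClosure.isAlgebraic ℚ
  have σ : AlgebraicClosure ℚ →+* ℂ := (IsAlgClosed.lift (R := ℚ) (M := ℂ)).toRingHom
  have hcoef : ∀ n, PowerSeries.coeff n (toC F) = ((PowerSeries.coeff n F : ℚ) : ℂ) := fun n => by
    simp [toC]
  have hle : ∀ n ≥ n₀, ‖PowerSeries.coeff n (toC F)‖ ≤ 1 := by
    intro n hn
    have h1 := hn₀ n hn σ
    rw [Real.rpow_one, map_mul, map_natCast, norm_mul, Complex.norm_natCast, PowerSeries.coeff_map,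
      eq_ratCast, map_ratCast, ← hcoef] at h1
    have h2 : (0 : ℝ) < n.factorial := by exact_mod_cast n.factorial_pos
    exact le_of_mul_le_mul_left (by linarith) h2
  intro z hz
  have hs : Summable fun n => ‖PowerSeries.coeff n (toC F) * z ^ n‖ := by
    refine summable_of_isBigO_nat (summable_geometric_of_lt_one (norm_nonneg z) hz) ?_
    refine Asymptotics.IsBigO.of_bound 1 ?_
    filter_upwards [Filter.eventually_ge_atTop n₀] with n hn
    rw [norm_norm, norm_mul, norm_pow, norm_pow, norm_norm]
    exact mul_le_mul_of_nonneg_right (hle n hn) (by positivity)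
  refine ⟨hs, ?_⟩
  have := hs.of_norm.hasSum
  simpa only [hcoef, evalSeries] using this

theorem coeff_laurentToSeries (s : ℚ[T;T⁻¹]) (n : ℤ) :
    (laurentToSeries s).coeff n = ((s.coeff n : ℚ) : ℂ) := by
  induction s using LaurentPolynomial.induction_on' with
  | add p q hp hq =>
    rw [laurentToSeries_add, HahnSeries.coeff_add, hp, hq, AddMonoidAlgebra.coeff_add]
    simp
  | C_mul_T k a =>
    rw [← LaurentPolynomial.single_eq_C_mul_T, laurentToSeries_single, HahnSeries.coeff_single,
      AddMonoidAlgebra.coeff_single, Finsupp.single_apply]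
    by_cases h : k = n
    · subst h; simp
    · simp [h, Ne.symm h]

/-- The independence of `1, f₁, …, f_m` over `ℂ(z)`, as an assertion on functions on `ℂ \ {0}`. -/
theorem IndependentOverRational.eq_zero {m : ℕ} {f : Fin m → PowerSeries ℚ}
    (hlin : IndependentOverRational f) (hf : ∀ j, HasSeries (toC (f j)) (evalSeries (f j)))
    {D : Fin (m + 1) → ℚ[T;T⁻¹]}
    (hD : ∀ z : ℂ, z ≠ 0 →
      evalLaurent (D 0) z + ∑ j : Fin m, evalLaurent (D j.succ) z * evalSeries (f j) z = 0) :
    ∀ j, D j = 0 := by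
  choose d₀ h using fun j => exists_clear_laurent (D j)
  set d := (∑ j, d₀ j) + 1
  have hle : ∀ j, d ≥ d₀ j := fun j =>
    (Finset.single_le_sum (f := d₀) (fun _ _ => Nat.zero_le _) (Finset.mem_univ j)).trans
      (Nat.le_succ _)
  choose c hc hc' using fun j => h j d (hle j)
  -- the additional factor `z` makes the relation hold at `z = 0` too
  have hser : HasSeries (((Polynomial.X * c 0 : ℂ[X]) : PowerSeries ℂ) +
      ∑ j : Fin m, ((Polynomial.X * c j.succ : ℂ[X]) : PowerSeries ℂ) * toC (f j)) fun _ => 0 := by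
    have h1 := (hasSeries_polynomial (Polynomial.X * c 0)).add
      (HasSeries.sum Finset.univ fun j _ =>
        (hasSeries_polynomial (Polynomial.X * c (Fin.succ j))).mul (hf j))
    convert! h1 using 1
    · ext z
      by_cases hz : z = 0
      · simp [hz]
      · have h2 := hD z hz
        simp only [Polynomial.eval_mul, Polynomial.eval_X, ← hc _ z hz]
        have : z * z ^ d * (evalLaurent (D 0) z +
            ∑ j : Fin m, evalLaurent (D j.succ) z * evalSeries (f j) z) = 0 := by rw [h2, mul_zero]
        rw [← this, mul_add, Finset.mul_sum]
        congr 1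
        · ring
        · exact Finset.sum_congr rfl fun j _ => by ring
  have hzero := hser.eq_zero
  have h3 : ∑ j, (algebraMap ℂ[X] (RatFunc ℂ) (Polynomial.X * c j)) • oneAndSeries f j = 0 := by
    have h4 : ∀ (p : ℂ[X]) (x : LaurentSeries ℂ), (algebraMap ℂ[X] (RatFunc ℂ) p) • x =
        HahnSeries.ofPowerSeries ℤ ℂ (p : PowerSeries ℂ) * x := fun p x => by
      rw [Algebra.smul_def]
      congr 1
      exact (RatFunc.coe_coe p).symm
    have h5 := congrArg (HahnSeries.ofPowerSeries ℤ ℂ) hzero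
    rw [Fin.sum_univ_succ]
    simp only [h4, oneAndSeries, Fin.cons_zero, Fin.cons_succ, mul_one]
    rw [map_zero, map_add, map_sum] at h5
    simpa only [map_mul, Polynomial.coe_mul, Polynomial.coe_X] using h5
  have h6 := Fintype.linearIndependent_iff.1 hlin _ h3
  intro j
  have h7 : c j = 0 := by
    have := (FaithfulSMul.algebraMap_eq_zero_iff ℂ[X] (RatFunc ℂ)).1 (h6 j)
    simpa using this
  have h8 := hc' j
  rw [h7, Polynomial.coe_zero, map_zero] at h8
  ext n
  have h9 := congrArg (fun x => HahnSeries.coeff x (n + d)) h8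
  simp only [HahnSeries.coeff_single_mul, add_sub_cancel_right, one_mul, coeff_laurentToSeries,
    HahnSeries.coeff_zero] at h9
  simpa using h9

/-- The system satisfied by `f₁, …, f_m` is unique. -/
theorem SolvesInhomogeneous.unique {m : ℕ} {f : Fin m → PowerSeries ℚ}
    (hlin : IndependentOverRational f) (hf : ∀ j, HasSeries (toC (f j)) (evalSeries (f j)))
    {S S' : Fin m → Fin (m + 1) → ℚ[T;T⁻¹]} (hS : SolvesInhomogeneous S f)
    (hS' : SolvesInhomogeneous S' f) : S = S' := by
  funext l
  have hsub : ∀ (s t : ℚ[T;T⁻¹]) z, evalLaurent (s - t) z = evalLaurent s z - evalLaurent t z :=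
    fun s t z => by
      have := evalLaurent_add (s - t) t z
      rw [sub_add_cancel] at this
      rw [this]; ring
  have := hlin.eq_zero hf (D := fun j => S l j - S' l j) fun z hz => by
    have h1 := (hS l z hz).unique (hS' l z hz)
    simp only [hsub, sub_mul, Finset.sum_sub_distrib]
    linear_combination h1
  funext j
  exact sub_eq_zero.1 (this j)

end Series

/-! ### The graded solutions and their remainders -/

section Assembly
variable {m N : ℕ}

theorem tendsto_log_stripLeft :
    Filter.Tendsto Complex.log (𝓝[Complex.slitPlane] 0) (stripLeft Real.pi) := by
  refine Filter.tendsto_inf.2 ⟨Filter.tendsto_comap_iff.2 ?_, Filter.tendsto_principal.2 ?_⟩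
  · have h1 : Filter.Tendsto (fun z : ℂ => ‖z‖) (𝓝[Complex.slitPlane] 0) (𝓝[>] 0) := by
      refine tendsto_nhdsWithin_iff.2 ⟨?_, ?_⟩
      · exact (continuous_norm.tendsto' 0 0 norm_zero).mono_left nhdsWithin_le_nhds
      · filter_upwards [self_mem_nhdsWithin] with z hz
        exact norm_pos_iff.2 (Complex.slitPlane_ne_zero hz)
    have := Real.tendsto_log_nhdsGT_zero.comp h1
    convert! this using 1
    ext z; simp [Complex.log_re]
  · exact Filter.Eventually.of_forall fun z =>
      abs_le.2 ⟨(Complex.neg_pi_lt_log_im z).le, Complex.log_im_le_pi z⟩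

/-- The matrix of the homogeneous system satisfied by `(1, f₁, …, f_m)`. -/
def augmentedMatrix (S : Fin m → Fin (m + 1) → ℚ[T;T⁻¹]) :
    Matrix (Fin (m + 1)) (Fin (m + 1)) ℚ[T;T⁻¹] :=
  Matrix.of (Fin.cons (fun _ => 0) S)

theorem homogeneousMatrix_eq_map (S : Fin m → Fin (m + 1) → ℚ[T;T⁻¹]) :
    homogeneousMatrix S = (augmentedMatrix S).map laurentToSeries := by
  have h0 : laurentToSeries 0 = 0 := by simp [laurentToSeries]
  ext1 i j
  refine Fin.cases ?_ (fun i => ?_) i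
  · exact h0.symm
  · rfl

/-- The linear forms `u_l = ∑ᵢ U_{i,l} tᵢ`: the general solution `U t` of the system adjoint to the
homogeneous system `y' = (S_{l,j})_{l, j ≥ 1} y`. -/
def linearForm (U : Matrix (Fin (m + 1)) (Fin (m + 1)) ℂ) (l : Fin m) : MvPolynomial (Fin m) ℂ :=
  ∑ i, MvPolynomial.C (U i.succ l.succ) * MvPolynomial.X i

theorem hasDerivAt_adjoint_log {S : Fin m → Fin (m + 1) → ℚ[T;T⁻¹]}
    {U : ℂ → Matrix (Fin (m + 1)) (Fin (m + 1)) ℂ}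
    (hU : ∀ s i j, HasDerivAt (fun s => U s i j) (-∑ l, U s i l *
      (Complex.exp s * evalLaurent (augmentedMatrix S l j) (Complex.exp s))) s)
    {z : ℂ} (hz : z ∈ Complex.slitPlane) (i j : Fin m) :
    HasDerivAt (fun z => U (Complex.log z) i.succ j.succ)
      (-∑ l : Fin m, U (Complex.log z) i.succ l.succ * evalLaurent (S l j.succ) z) z := by
  have hz0 : z ≠ 0 := Complex.slitPlane_ne_zero hz
  have h0 : evalLaurent 0 z = 0 := by simp [evalLaurent]
  have h2 := (hU (Complex.log z) i.succ j.succ).comp z (Complex.hasDerivAt_log hz)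
  rw [Complex.exp_log hz0, Fin.sum_univ_succ] at h2
  have e0 : augmentedMatrix S 0 j.succ = 0 := by simp [augmentedMatrix]
  have e1 : ∀ l : Fin m, augmentedMatrix S l.succ j.succ = S l j.succ := fun l => by
    simp [augmentedMatrix]
  simp only [e0, e1, h0, mul_zero, zero_add, neg_mul, Finset.sum_mul] at h2
  have e2 : ∀ l : Fin m, U (Complex.log z) i.succ l.succ * (z * evalLaurent (S l j.succ) z) * z⁻¹ =
      U (Complex.log z) i.succ l.succ * evalLaurent (S l j.succ) z := fun l => by
    field_simp
  simp only [e2] at h2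
  exact h2

theorem hasCoeffDerivAt_linearForm {S : Fin m → Fin (m + 1) → ℚ[T;T⁻¹]}
    {U : ℂ → Matrix (Fin (m + 1)) (Fin (m + 1)) ℂ}
    (hU : ∀ s i j, HasDerivAt (fun s => U s i j) (-∑ l, U s i l *
      (Complex.exp s * evalLaurent (augmentedMatrix S l j) (Complex.exp s))) s)
    {z : ℂ} (hz : z ∈ Complex.slitPlane) (j : Fin m) :
    HasCoeffDerivAt (fun z => linearForm (U (Complex.log z)) j)
      (-∑ l, evalLaurent (S l j.succ) z • linearForm (U (Complex.log z)) l) z := by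
  have h3 := HasCoeffDerivAt.sum (t := Finset.univ) fun i _ =>
    (hasCoeffDerivAt_C (m := m) (hasDerivAt_adjoint_log hU hz i j)).mul
      (hasCoeffDerivAt_const (MvPolynomial.X i) z)
  have e : ∑ i : Fin m, (MvPolynomial.C (-∑ l : Fin m, U (Complex.log z) i.succ l.succ *
        evalLaurent (S l j.succ) z) * MvPolynomial.X i +
      MvPolynomial.C (U (Complex.log z) i.succ j.succ) * 0) =
      -∑ l, evalLaurent (S l j.succ) z • linearForm (U (Complex.log z)) l := by
    simp only [linearForm, mul_zero, add_zero, MvPolynomial.smul_eq_C_mul, Finset.mul_sum, map_neg,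
      map_sum, map_mul, neg_mul, Finset.sum_neg_distrib, Finset.sum_mul]
    rw [Finset.sum_comm]
    refine congrArg Neg.neg (Finset.sum_congr rfl fun l _ => Finset.sum_congr rfl fun i _ => ?_)
    rw [← mul_assoc, mul_comm (MvPolynomial.C (evalLaurent _ _))]
  rw [e] at h3
  exact h3

/-- The solutions `Y_κ` of the graded system: coefficients of `t ^ κ` in the generating solution. -/
def gradedY (f : Fin m → PowerSeries ℚ) (U : ℂ → Matrix (Fin (m + 1)) (Fin (m + 1)) ℂ) (N : ℕ)
    (κ : Fin m → ℕ) (z : ℂ) (lam : Omega m N) : ℂ :=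
  MvPolynomial.coeff (Finsupp.equivFunOnFinite.symm κ)
    (gradedSolution N (linearForm (U (Complex.log z)))
      (∑ j, evalSeries (f j) z • linearForm (U (Complex.log z)) j) lam.1)

theorem isSolution_gradedY {f : Fin m → PowerSeries ℚ} {S : Fin m → Fin (m + 1) → ℚ[T;T⁻¹]}
    {U : ℂ → Matrix (Fin (m + 1)) (Fin (m + 1)) ℂ}
    (hU : ∀ s i j, HasDerivAt (fun s => U s i j) (-∑ l, U s i l *
      (Complex.exp s * evalLaurent (augmentedMatrix S l j) (Complex.exp s))) s)
    (hS : SolvesInhomogeneous S f) (κ : Fin m → ℕ) :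
    IsSolution (systemMatrix S N) (gradedY f U N κ) := by
  intro z hz
  have hz0 : z ≠ 0 := Complex.slitPlane_ne_zero hz
  set u : Fin m → MvPolynomial (Fin m) ℂ := linearForm (U (Complex.log z)) with hu
  have hder := hasCoeffDerivAt_linearForm hU hz
  -- the derivative of `∑ f_j u_j`: the terms in `S_{l,j}`, `j ≥ 1`, cancel
  have hF : HasCoeffDerivAt
      (fun z => ∑ j, evalSeries (f j) z • linearForm (U (Complex.log z)) j)
      (∑ j, evalLaurent (S j 0) z • u j) z := by
    have h1 := HasCoeffDerivAt.sum (t := Finset.univ) fun j _ =>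
      (hasCoeffDerivAt_C (m := m) (hS j z hz0)).mul (hder j)
    simp only [MvPolynomial.smul_eq_C_mul] at h1 ⊢
    convert h1 using 1
    simp only [map_add, map_sum, map_mul, add_mul, Finset.sum_add_distrib, Finset.sum_mul, mul_neg,
      Finset.sum_neg_distrib, Finset.mul_sum]
    rw [add_assoc, left_eq_add, Finset.sum_comm, ← sub_eq_add_neg, sub_eq_zero]
    exact Finset.sum_congr rfl fun i _ => Finset.sum_congr rfl fun l _ => by ring
  refine hasDerivAt_pi.2 fun lam => ?_
  have hG : HasCoeffDerivAt (fun z => if ∑ j, lam.1 j = N then (1 : MvPolynomial (Fin m) ℂ) else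
      ∑ j, evalSeries (f j) z • linearForm (U (Complex.log z)) j)
      (if ∑ j, lam.1 j = N then 0 else ∑ j, evalLaurent (S j 0) z • u j) z := by
    split_ifs
    · exact hasCoeffDerivAt_const 1 z
    · exact hF
  have h2 := (hasCoeffDerivAt_mono hder lam.1).mul hG
  have h3 := sum_systemMatrix_smul S z u (∑ j, evalSeries (f j) z • u j) lam
  rw [← h3] at h2
  have h4 := h2 (Finsupp.equivFunOnFinite.symm κ)
  simp only [MvPolynomial.coeff_sum, MvPolynomial.coeff_smul, smul_eq_mul] at h4
  exact h4

theorem coeff_mono_X (κ lam : Fin m → ℕ) :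
    MvPolynomial.coeff (Finsupp.equivFunOnFinite.symm κ)
      (mono (MvPolynomial.X : Fin m → MvPolynomial (Fin m) ℂ) lam) = if lam = κ then 1 else 0 := by
  have h : mono (MvPolynomial.X : Fin m → MvPolynomial (Fin m) ℂ) lam =
      MvPolynomial.monomial (Finsupp.equivFunOnFinite.symm lam) 1 := by
    rw [MvPolynomial.monomial_eq, map_one, one_mul, Finsupp.prod_fintype _ _ (by simp)]
    rfl
  rw [h, MvPolynomial.coeff_monomial]
  simp

theorem gradedY_one {f : Fin m → PowerSeries ℚ} {U : ℂ → Matrix (Fin (m + 1)) (Fin (m + 1)) ℂ}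
    (hU0 : U 0 = 1) {κ : Fin m → ℕ} (hκ : κ ∈ Theta m N) :
    gradedY f U N κ 1 = Z f N κ := by
  have hu : linearForm (U (Complex.log 1)) = (MvPolynomial.X : Fin m → MvPolynomial (Fin m) ℂ) := by
    funext l
    rw [Complex.log_one, hU0, linearForm, Finset.sum_eq_single l]
    · simp
    · intro i _ hi
      rw [Matrix.one_apply_ne (fun h => hi (Fin.succ_injective _ h))]; simp
    · simp
  funext lam
  rw [gradedY, hu, gradedSolution, Z]
  rw [mem_Theta] at hκ
  have hlam := mem_Omega.1 lam.2
  by_cases h : ∑ j, lam.1 j = N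
  · rw [if_pos h, mul_one, coeff_mono_X, Finset.sum_eq_zero, add_zero]
    intro j _
    refine if_neg fun h' => ?_
    have := sum_add_e lam.1 j
    rw [h', hκ] at this
    omega
  · rw [if_neg h, if_neg (fun h' => h (by rw [h', hκ])), zero_add, Finset.mul_sum,
      MvPolynomial.coeff_sum]
    refine Finset.sum_congr rfl fun j _ => ?_
    rw [mul_smul_comm, MvPolynomial.coeff_smul, ← mono_add_e, coeff_mono_X]
    simp

theorem Z_of_mem_Theta (f : Fin m → PowerSeries ℚ) {κ κ' : Fin m → ℕ} (hκ : κ ∈ Theta m N)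
    (hκ' : κ' ∈ Theta m N) (h : κ' ∈ Omega m N) :
    Z f N κ ⟨κ', h⟩ = if κ' = κ then 1 else 0 := by
  rw [Z, Finset.sum_eq_zero, add_zero]
  intro j _
  refine if_neg fun h' => ?_
  have := sum_add_e κ' j
  rw [h', mem_Theta.1 hκ, mem_Theta.1 hκ'] at this
  omega

theorem linearIndependent_of_eq_Z {f : Fin m → PowerSeries ℚ}
    {Y : Theta m N → ℂ → Omega m N → ℂ} (hY : ∀ κ, Y κ 1 = Z f N κ) :
    LinearIndependent ℂ (fun κ => Complex.slitPlane.domRestrict (Y κ)) := by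
  rw [Fintype.linearIndependent_iff]
  intro g hg κ₀
  have hmem : κ₀.1 ∈ Omega m N := by
    have := mem_Theta.1 κ₀.2
    rw [mem_Omega]; omega
  have h1 := congrFun (congrFun hg ⟨1, Complex.one_mem_slitPlane⟩) ⟨κ₀.1, hmem⟩
  simp only [Finset.sum_apply, Pi.smul_apply, Set.domRestrict_apply, hY, smul_eq_mul,
    Pi.zero_apply] at h1
  rw [Finset.sum_eq_single κ₀] at h1
  · rwa [Z_of_mem_Theta f κ₀.2 κ₀.2, if_pos rfl, mul_one] at h1
  · intro κ _ hκ
    rw [Z_of_mem_Theta f κ.2 κ₀.2, if_neg (fun h => hκ (Subtype.ext h.symm)), mul_zero]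
  · simp

theorem remainder_gradedY (f : Fin m → PowerSeries ℚ)
    (U : ℂ → Matrix (Fin (m + 1)) (Fin (m + 1)) ℂ) (P : (Fin m → ℕ) → ℂ[X]) (κ : Fin m → ℕ)
    (z : ℂ) :
    remainder P (gradedY f U N κ) z = ∑ κ' ∈ Theta m N,
      ((P κ').eval z + ∑ j, (shift P κ' j).eval z * evalSeries (f j) z) *
        MvPolynomial.coeff (Finsupp.equivFunOnFinite.symm κ)
          (mono (linearForm (U (Complex.log z))) κ') := by
  have h := congrArg (MvPolynomial.coeff (Finsupp.equivFunOnFinite.symm κ))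
    (sum_smul_gradedSolution (N := N) P z (fun j => evalSeries (f j) z)
      (linearForm (U (Complex.log z))))
  simp only [MvPolynomial.coeff_sum, MvPolynomial.coeff_smul, smul_eq_mul] at h
  exact h

theorem coeffIsBigO_linearForm {U : ℂ → Matrix (Fin (m + 1)) (Fin (m + 1)) ℂ} {c : ℝ}
    (hU : ∀ i j, (fun s => U s i j) =O[stripLeft Real.pi] fun s => Real.exp (-(c * s.re)))
    (l : Fin m) : CoeffIsBigO (fun s => linearForm (U s) l) c := fun κ => by
  simp only [linearForm, MvPolynomial.coeff_sum, MvPolynomial.coeff_C_mul]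
  exact Asymptotics.IsBigO.fun_sum fun i _ => by
    simpa only [mul_comm] using (hU i.succ l.succ).const_mul_left
      (MvPolynomial.coeff κ (MvPolynomial.X i))

theorem coeffMem_linearForm {U : ℂ → Matrix (Fin (m + 1)) (Fin (m + 1)) ℂ}
    (hU : ∀ i j, (fun s => U s i j) ∈ nilssonSpan) (l : Fin m) :
    CoeffMem fun s => linearForm (U s) l := fun κ => by
  have : (fun s => MvPolynomial.coeff κ (linearForm (U s) l)) =
      ∑ i : Fin m, MvPolynomial.coeff κ (MvPolynomial.X i : MvPolynomial (Fin m) ℂ) •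
        fun s => U s i.succ l.succ := by
    ext s
    simp only [linearForm, MvPolynomial.coeff_sum, MvPolynomial.coeff_C_mul, Finset.sum_apply,
      Pi.smul_apply, smul_eq_mul]
    exact Finset.sum_congr rfl fun i _ => mul_comm _ _
  rw [this]
  exact Submodule.sum_mem _ fun i _ => Submodule.smul_mem _ _ (hU _ _)

end Assembly

end GradedPade

end

theorem mainTheorem8 (m : ℕ) (hm : 1 ≤ m) (f : Fin m → PowerSeries ℚ)
    (hE : ∀ j, GradedPade.IsEFunction ((f j).map (algebraMap ℚ (AlgebraicClosure ℚ))))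
    (hlin : GradedPade.IndependentOverRational f) :
    ∃ c : ℝ, 0 < c ∧
      ∀ S : Fin m → Fin (m + 1) → LaurentPolynomial ℚ,
        GradedPade.SolvesInhomogeneous S f →
        GradedPade.IsRegularSingularAtZero (GradedPade.homogeneousMatrix S) →
      ∀ N : ℕ, 1 ≤ N → ∀ η : ℝ, 0 < η → η ≤ 1 / (3 * ((N : ℝ) + m - 1)) →
      ∀ M : ℕ, ∀ P : (Fin m → ℕ) → Polynomial ℂ,
        GradedPade.IsGradedPade f N M (GradedPade.paramK m N M η) P →
      ∃ Y : GradedPade.Theta m N → ℂ → GradedPade.Omega m N → ℂ,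
        (∀ κ, GradedPade.IsSolution (GradedPade.systemMatrix S N) (Y κ)) ∧
        (∀ κ, Y κ 1 = GradedPade.Z f N κ) ∧
        LinearIndependent ℂ (fun κ => Complex.slitPlane.domRestrict (Y κ)) ∧
        (∀ κ, (fun z : ℂ => GradedPade.remainder P (Y κ) z)
          =O[𝓝[Complex.slitPlane] (0 : ℂ)]
            fun z : ℂ => ‖z‖ ^ ((GradedPade.paramK m N M η : ℝ) - c * N)) ∧
        (∀ κ, GradedPade.IsNilsson (GradedPade.remainder P (Y κ))) := by
  have hser := fun j => (hE j).hasSeries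
  -- the constant is read off from the system, which `f` determines if it exists
  by_cases hex : ∃ S : Fin m → Fin (m + 1) → LaurentPolynomial ℚ,
      GradedPade.SolvesInhomogeneous S f ∧
        GradedPade.IsRegularSingularAtZero (GradedPade.homogeneousMatrix S)
  swap
  · exact ⟨1, one_pos, fun S hS hreg => absurd ⟨S, hS, hreg⟩ hex⟩
  obtain ⟨S₀, hS₀, hreg₀⟩ := hex
  rw [GradedPade.homogeneousMatrix_eq_map] at hreg₀
  obtain ⟨U, hU0, hU, hUmem, c₀, hUc₀⟩ := hreg₀.exists_fundamental_matrix
  set c := max c₀ 1 with hc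
  have hUc : ∀ i j, (fun s => U s i j) =O[GradedPade.stripLeft Real.pi]
      fun s => Real.exp (-(c * s.re)) := fun i j =>
    (hUc₀ i j).trans (GradedPade.isBigO_exp_of_le (le_max_left _ _))
  refine ⟨c, lt_max_of_lt_right one_pos, fun S hS _ N _ η _ _ M P hP => ?_⟩
  obtain rfl : S = S₀ := hS.unique hlin hser hS₀
  -- the linear forms of the graded approximation problem, as functions and as power series
  have hg : ∀ κ, GradedPade.HasSeries
      ((P κ : PowerSeries ℂ) + ∑ j : Fin m,
        (GradedPade.shift P κ j : PowerSeries ℂ) * GradedPade.toC (f j))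
      (fun z => (P κ).eval z +
        ∑ j, (GradedPade.shift P κ j).eval z * GradedPade.evalSeries (f j) z) := fun κ =>
    (GradedPade.hasSeries_polynomial _).add (GradedPade.HasSeries.sum _ fun j _ =>
      (GradedPade.hasSeries_polynomial _).mul (hser j))
  have hY1 : ∀ κ : GradedPade.Theta m N,
      GradedPade.gradedY f U N κ.1 1 = GradedPade.Z f N κ.1 := fun κ =>
    GradedPade.gradedY_one hU0 κ.2
  refine ⟨fun κ => GradedPade.gradedY f U N κ.1, fun κ => GradedPade.isSolution_gradedY hU hS κ.1,
    hY1, GradedPade.linearIndependent_of_eq_Z hY1, fun κ => ?_, fun κ => ?_⟩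
  · simp only [GradedPade.remainder_gradedY]
    refine Asymptotics.IsBigO.fun_sum fun κ' hκ' => ?_
    have h1 := ((hg κ').isBigO (hP.le_order κ' hκ')).mono
      (nhdsWithin_le_nhds (s := Complex.slitPlane))
    have h2 := (GradedPade.CoeffIsBigO.mono (GradedPade.coeffIsBigO_linearForm hUc) κ'
      (Finsupp.equivFunOnFinite.symm κ.1)).comp_tendsto GradedPade.tendsto_log_stripLeft
    refine (h1.mul h2).congr' Filter.EventuallyEq.rfl ?_
    filter_upwards [self_mem_nhdsWithin] with z hz
    have hz0 : 0 < ‖z‖ := norm_pos_iff.2 (Complex.slitPlane_ne_zero hz)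
    rw [Real.rpow_sub hz0, Real.rpow_natCast, Function.comp_apply, GradedPade.mem_Theta.1 hκ',
      Complex.log_re, Real.exp_neg, div_eq_mul_inv, Real.rpow_def_of_pos hz0]
    congr 3
    ring
  · refine GradedPade.isNilsson_of_mem
      (w := ∑ κ' ∈ GradedPade.Theta m N, (fun s => (P κ').eval (Complex.exp s) +
        ∑ j, (GradedPade.shift P κ' j).eval (Complex.exp s) *
          GradedPade.evalSeries (f j) (Complex.exp s)) *
        fun s => MvPolynomial.coeff (Finsupp.equivFunOnFinite.symm κ.1)
          (GradedPade.mono (GradedPade.linearForm (U s)) κ'))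
      (Submodule.sum_mem _ fun κ' _ => GradedPade.mul_mem_nilssonSpan
        (GradedPade.analytic_mem (hg κ').analyticAt)
        (GradedPade.coeffMem_mono (GradedPade.coeffMem_linearForm hUmem) κ' _)) ?_
    filter_upwards [self_mem_nhdsWithin] with z hz
    rw [GradedPade.remainder_gradedY]
    simp only [Finset.sum_apply, Pi.mul_apply, Complex.exp_log (Complex.slitPlane_ne_zero hz)]
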